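/- Let $d>0$, $\mathcal D_d=\{z\in\mathbb C: |\mathrm{Im}\,z|<d\}$, and let $w:\mathcal D_d\to\mathbb C$ be a weight function such that 1. $w$ is analytic in $\mathcal D_d$, $\int_{-d}^{d}|w(x+iy)|\,dy\to 0$ as $x\to\pm\infty$, the limit $\lim_{y\to d-0}\int_{-\infty}^{\infty}(|w(x+iy)|+|w(x-iy)|)\,dx$ exists and is finite, $w$ has no zero in $\mathcal D_d$, and $w>0$ on $\mathbb R$; 2. $w$ is even on $\mathbb R$; 3. $\log w$ is concave on $\mathbb R$. Let $H^\infty(\mathcal D_d,w)$ be the space of the functions $f$ analytic in $\mathcal D_d$ with $\|f\|:=\sup_{z\in\mathcal D_d}|f(z)/w(z)|<\infty$. For each integer $N\ge 1$: - let $\tilde\alpha_N^*>0$ be the positive solution $\alpha$ of $$-\frac1{\pi d}\int_{-\alpha}^{\alpha}\frac{x\,w'(x)}{w(x)}\,dx-\frac{4(\pi\alpha+2d)}{\pi^3}\,\frac{w'(\alpha)}{w(\alpha)}=2(N+1),$$ and put $$\tilde K_N^*=-\log w(\tilde\alpha_N^*)-\frac{2d}{\pi}\,\frac{w'(\tilde\alpha_N^*)}{w(\tilde\alpha_N^*)};$$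 - with $\alpha=\tilde\alpha_N^*$, let $\tilde\nu_N:\mathbb R\to\mathbb R$, $\tilde\nu_N(x)=\frac1{2\pi}\int_{-\infty}^\infty F_N(\omega)e^{i\omega x}\,d\omega$, be the inverse Fourier transform of $$F_N(\omega)=\frac{1}{i\pi\tanh(d\omega)}\int_{-\alpha}^{\alpha}\frac{w'(x)}{w(x)}e^{-i\omega x}\,dx-\frac{4d}{\pi}\,\frac{w'(\alpha)}{w(\alpha)}\,\frac{\pi\sin(\alpha\omega)+2d\,\omega\cos(\alpha\omega)}{(\pi^2+4d^2\omega^2)\tanh(d\omega)};$$ - let $a_{-N},\dots,a_N\in\mathbb R$ (depending on $N$) be the sampling points with $\int_0^{a_i}\tilde\nu_N(t)\,dt=i$ for $i=-N,\dots,N$; - for $f\in H^\infty(\mathcal D_d,w)$ and $x\in\mathbb R$ put $$\tilde f_N(x)=\sum_{j=-N}^{N} f(a_j)\,\frac{B_{N;j}(x)\,w(x)}{B_{N;j}(a_j)\,w(a_j)}\,\frac{4d}{\pi}\,T_d'(a_j-x),$$ where $T_d(x)=\tanh\left(\frac{\pi}{4d}x\right)$ and $B_{N;j}(x)=\prod_{-N\le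 m\le N,\ m\ne j}T_d(x-a_m)$. Suppose that there are constants $c>0$ and $\lambda>0$, independent of $N$, such that for every $N\ge1$ $$\max_{x\in[-\tilde\alpha_N^*,\tilde\alpha_N^*]}|\tilde\nu_N(x)|\le c\,N^{\lambda}.$$ Then there are constants $C$, $c'$ and $N_0$, independent of $f$ and $N$, such that for all $N\ge N_0$ and all $f\in H^\infty(\mathcal D_d,w)$ $$\sup_{x\in\mathbb R}\bigl|f(x)-\tilde f_N(x)\bigr|\le C\,\|f\|\,N^{c'}\exp(-\tilde K_N^*).$$ -/

import Mathlib

open Filter Topology MeasureTheory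

noncomputable section

namespace StripApprox

/-- The strip `𝒟_d = {z ∈ ℂ : |Im z| < d}`. -/
def strip (d : ℝ) : Set ℂ := {z : ℂ | |z.im| < d}

/-- The function space `B(𝒟_d)`: functions analytic in the strip whose integrals over vertical
cross sections tend to `0` at `±∞`, and whose integrals over the two horizontal lines
`Im z = ±y` have a finite limit as `y → d - 0`.  The integrals of absolute values are
`[0, ∞]`-valued. -/
structure MemB (d : ℝ) (ζ : ℂ → ℂ) : Prop where
  analytic : DifferentiableOn ℂ ζ (strip d)
  vertical_top : Tendsto
    (fun x : ℝ => ∫⁻ y in Set.Ioo (-d) d, ‖ζ (x + y * Complex.I)‖ₑ) atTop (𝓝 0)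
  vertical_bot : Tendsto
    (fun x : ℝ => ∫⁻ y in Set.Ioo (-d) d, ‖ζ (x + y * Complex.I)‖ₑ) atBot (𝓝 0)
  horizontal : ∃ L : ENNReal, L < ⊤ ∧ Tendsto
    (fun y : ℝ => ∫⁻ x : ℝ, (‖ζ (x + y * Complex.I)‖ₑ + ‖ζ (x - y * Complex.I)‖ₑ))
    (𝓝[<] d) (𝓝 L)

/-- The restriction of `w` to the real line, as a real function. -/
def realPart (w : ℂ → ℂ) (x : ℝ) : ℝ := (w x).re

/-- Weight functions on the strip: `w` lies in `B(𝒟_d)`, has no zero in the strip, is positive on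
the real axis, is even on `ℝ`, and `log w` is concave on `ℝ`. -/
structure IsWeight (d : ℝ) (w : ℂ → ℂ) : Prop where
  memB : MemB d w
  ne_zero : ∀ z ∈ strip d, w z ≠ 0
  real_pos : ∀ x : ℝ, (w x).im = 0 ∧ 0 < (w x).re
  even : ∀ x : ℝ, w (-x : ℝ) = w x
  concave : ConcaveOn ℝ Set.univ (fun x : ℝ => Real.log (realPart w x))

/-- Membership in the weighted Hardy space `H^∞(𝒟_d, w)`. -/
def MemHardy (d : ℝ) (w f : ℂ → ℂ) : Prop :=
  DifferentiableOn ℂ f (strip d) ∧ BddAbove (Set.range fun z : strip d => ‖f z / w z‖)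

/-- The norm `‖f‖ = sup_{z ∈ 𝒟_d} |f(z) / w(z)|`. -/
def hardyNorm (d : ℝ) (w f : ℂ → ℂ) : ℝ := ⨆ z : strip d, ‖f z / w z‖

/-- `w'(x) / w(x)` for real `x`. -/
def logDerivReal (w : ℂ → ℂ) (x : ℝ) : ℝ := deriv (realPart w) x / realPart w x

/-- `α` is the positive solution `α̃*_N` of the equation that determines the end point:
`-(1/(πd)) ∫_{-α}^{α} x w'(x)/w(x) dx - (4(πα + 2d)/π³) w'(α)/w(α) = 2(N+1)`. -/
def IsEndpoint (d : ℝ) (w : ℂ → ℂ) (N : ℕ) (α : ℝ) : Prop :=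
  0 < α ∧
  -(1 / (Real.pi * d)) * (∫ x in (-α)..α, x * logDerivReal w x)
    - 4 * (Real.pi * α + 2 * d) / Real.pi ^ 3 * logDerivReal w α = 2 * ((N : ℝ) + 1)

/-- `K(α) = -log w(α) - (2d/π) w'(α)/w(α)`. -/
def rateK (d : ℝ) (w : ℂ → ℂ) (α : ℝ) : ℝ :=
  -Real.log (realPart w α) - 2 * d / Real.pi * logDerivReal w α

/-- The explicit Fourier transform `ℱ[ν̃](ω)` of the approximate density with end point `α`. -/
def densityFourier (d : ℝ) (w : ℂ → ℂ) (α ω : ℝ) : ℂ :=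
  1 / (Complex.I * Real.pi * Real.tanh (d * ω)) *
      (∫ x in (-α)..α, (logDerivReal w x : ℂ) * Complex.exp (-(Complex.I * ω * x)))
    - ((4 * d / Real.pi * logDerivReal w α *
        ((Real.pi * Real.sin (α * ω) + 2 * d * ω * Real.cos (α * ω)) /
          ((Real.pi ^ 2 + 4 * d ^ 2 * ω ^ 2) * Real.tanh (d * ω))) : ℝ) : ℂ)

/-- The density `ν̃`: the inverse Fourier transform
`ν̃(x) = (1/2π) ∫ ℱ[ν̃](ω) exp(iωx) dω`.  The value of this integral is real,
because `ℱ[ν̃]` is real and even. -/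
def density (d : ℝ) (w : ℂ → ℂ) (α x : ℝ) : ℝ :=
  (1 / (2 * Real.pi) *
    ∫ ω : ℝ, densityFourier d w α ω * Complex.exp (Complex.I * ω * x)).re

/-- The indefinite integral `I[ν̃](x) = ∫_0^x ν̃(t) dt`. -/
def densityIntegral (d : ℝ) (w : ℂ → ℂ) (α x : ℝ) : ℝ := ∫ t in (0 : ℝ)..x, density d w α t

/-- The points `a_{-N}, …, a_N` are sampling points generated by the density with end point `α`:
`a_i = I[ν̃]⁻¹(i)`, that is, `I[ν̃](a_i) = i`. -/
def IsSampling (d : ℝ) (w : ℂ → ℂ) (N : ℕ) (α : ℝ) (a : ℤ → ℝ) : Prop :=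
  ∀ i ∈ Finset.Icc (-(N : ℤ)) N, densityIntegral d w α (a i) = i

/-- `T_d(x) = tanh(πx/(4d))`. -/
def tanhStrip (d x : ℝ) : ℝ := Real.tanh (Real.pi / (4 * d) * x)

/-- `B_{N;k}(x) = ∏_{-N ≤ m ≤ N, m ≠ k} tanh((π/(4d)) (x - a_m))`. -/
def blaschkeOmit (d : ℝ) (N : ℕ) (a : ℤ → ℝ) (k : ℤ) (x : ℝ) : ℝ :=
  ∏ m ∈ (Finset.Icc (-(N : ℤ)) N).erase k, tanhStrip d (x - a m)

/-- The approximation formula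
`f̃_N(x) = ∑_j f(a_j) (B_{N;j}(x) w(x)) / (B_{N;j}(a_j) w(a_j)) (4d/π) T_d'(a_j - x)`. -/
def approx (d : ℝ) (w f : ℂ → ℂ) (N : ℕ) (a : ℤ → ℝ) (x : ℝ) : ℂ :=
  ∑ j ∈ Finset.Icc (-(N : ℤ)) N,
    f (a j) * ((blaschkeOmit d N a j x * w x) / (blaschkeOmit d N a j (a j) * w (a j))) *
      ((4 * d / Real.pi * deriv (tanhStrip d) (a j - x) : ℝ) : ℂ)

end StripApprox

end

/-!
The error is governed by a Green potential on the real axis. With `T(x) = tanh(πx/(4d))`, the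
formula `approx` collects the residues of `g(s) / (s B(s))` at the nodes, where `g = f / w` is
transported to the unit disc with the evaluation point `x` at the origin and `B` is the Blaschke
product of the nodes. Since `|B| = 1` on the unit circle, the error at `x` is at most
`‖f‖ w(x) ∏ |T(x - a_m)|` (`disc_interpolation_error`, `norm_sub_approx_le`). It remains to bound
`log w(x) - ∑ G(x - a_m)`, where `G = -log |T|` is the Green kernel `green`.

The density `ν` is chosen so that its potential `G * ν` is an explicit function `potential`, equal
to `log w + K` on `[-α, α]` and continued by a multiple of `exp(-π(|x| - α)/(2d))`. This is Fourier
inversion: `G` has transform `(π/ω) tanh(dω)`, and the transform of `ν` is `ω / (π tanh(dω))` times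
that of `potential` (`ft_green`, `densityFourier_eq`, `integral_green_mul_density`). Concavity of
`log w` gives `log w ≤ potential - K` on the whole line (`logWeight_le_potential`).

Positivity of `ν` and its bound outside `[-α, α]` come from the partial fractions
`ω coth(dω) = d⁻¹ (1 + 2 ∑ ω² / (ω² + c_n²))` with `c_n = nπ/d`, by which `πdν` is
`W + 2 ∑ (W - E_n * W)`, where `W` is `potential` and `E_n(t) = (c_n/2) exp(-c_n |t|)`
(`hasSum_potential_sub_expConv`). A function `M = A exp(-πx/(2d)) + B exp(πx/(2d))` satisfies
`E_n * M = 4n²/(4n² - 1) M`, and `2 ∑ 1/(4n² - 1) = 1`, so such functions contribute nothing.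
Concavity of `log w` lets one such `M` majorise `W` and touch it at any given point, whence `ν ≥ 0`
there; to the right of `α` one `M` agrees with `W`, and `ν` is a sum of averages of a nonnegative
function supported in `(-∞, α]`, so that `ν ≤ ν(α)` (`density_nonneg`, `density_le_endpoint`).
By Tonelli's theorem the mass of `ν` is `∫ W / ∫ G`, which the end point equation makes `2(N + 1)`.

Finally the potential is compared with the sum over the sampling points, which cut the line into
cells of mass one. Moving the mass of each cell to its end point nearer to `x` increases the
potential, so only the cell that contains `x` is lost; since `ν` is polynomially bounded, that cell
contributes `O(log N)`, that is, a power of `N` after exponentiation (`QuantileData.potential_le`,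
`setIntegral_green_mul_le`, `weight_mul_prod_tanh_le`).
-/

noncomputable section

namespace StripApprox

/-! ### Fourier transforms of two-sided exponentials -/

theorem integrable_exp_neg_abs_mul_cexp {c : ℝ} {z : ℂ} (hz : |z.re| < c) :
    Integrable fun x : ℝ => ((Real.exp (-(c * |x|)) : ℝ) : ℂ) * Complex.exp (z * x) := by
  have h := abs_lt.1 hz
  rw [← integrableOn_univ, ← Set.Iic_union_Ioi (a := (0 : ℝ))]
  refine IntegrableOn.union ?_ ?_
  · refine (integrableOn_exp_mul_complex_Iic (a := c + z) (by simp; linarith) 0).congr_fun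
      (fun x hx => ?_) measurableSet_Iic
    simp only [abs_of_nonpos (Set.mem_Iic.1 hx)]
    push_cast
    rw [← Complex.exp_add]
    ring_nf
  · refine (integrableOn_exp_mul_complex_Ioi (a := z - c) (by simp; linarith) 0).congr_fun
      (fun x hx => ?_) measurableSet_Ioi
    simp only [abs_of_pos (Set.mem_Ioi.1 hx)]
    push_cast
    rw [← Complex.exp_add]
    ring_nf

/-- For `z = -iω` a Fourier transform; real `z` gives exponential moments. -/
theorem integral_exp_neg_abs_mul_cexp {c : ℝ} {z : ℂ} (hz : |z.re| < c) :
    ∫ x : ℝ, ((Real.exp (-(c * |x|)) : ℝ) : ℂ) * Complex.exp (z * x) = 2 * c / (c ^ 2 - z ^ 2) := by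
  have h := abs_lt.1 hz
  have hi := integrable_exp_neg_abs_mul_cexp hz
  rw [← intervalIntegral.integral_Iic_add_Ioi (b := 0) hi.integrableOn hi.integrableOn]
  have h1 : ∫ x in Set.Iic (0 : ℝ), ((Real.exp (-(c * |x|)) : ℝ) : ℂ) * Complex.exp (z * x)
      = ∫ x in Set.Iic (0 : ℝ), Complex.exp ((c + z) * x) := by
    refine setIntegral_congr_fun measurableSet_Iic fun x hx => ?_
    simp only [abs_of_nonpos (Set.mem_Iic.1 hx)]
    push_cast
    rw [← Complex.exp_add]
    ring_nf
  have h2 : ∫ x in Set.Ioi (0 : ℝ), ((Real.exp (-(c * |x|)) : ℝ) : ℂ) * Complex.exp (z * x)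
      = ∫ x in Set.Ioi (0 : ℝ), Complex.exp ((z - c) * x) := by
    refine setIntegral_congr_fun measurableSet_Ioi fun x hx => ?_
    simp only [abs_of_pos (Set.mem_Ioi.1 hx)]
    push_cast
    rw [← Complex.exp_add]
    ring_nf
  rw [h1, h2, integral_exp_mul_complex_Iic (by simp; linarith),
    integral_exp_mul_complex_Ioi (by simp; linarith)]
  have e1 : (c : ℂ) + z ≠ 0 := fun h0 => by
    have := congrArg Complex.re h0
    simp at this; linarith
  have e2 : (z : ℂ) - c ≠ 0 := fun h0 => by
    have := congrArg Complex.re h0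
    simp at this; linarith
  have e3 : (c : ℂ) ^ 2 - z ^ 2 ≠ 0 := by
    have : (c : ℂ) ^ 2 - z ^ 2 = -((c + z) * (z - c)) := by ring
    rw [this]
    exact neg_ne_zero.2 (mul_ne_zero e1 e2)
  simp only [Complex.ofReal_zero, mul_zero, Complex.exp_zero]
  rw [div_add_div _ _ e1 e2, div_eq_div_iff (mul_ne_zero e1 e2) e3]
  ring

theorem integrable_exp_neg_abs {c : ℝ} (hc : 0 < c) :
    Integrable fun x : ℝ => Real.exp (-(c * |x|)) := by
  have := (integrable_exp_neg_abs_mul_cexp (c := c) (z := 0) (by simpa using hc)).re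
  simp only [zero_mul, Complex.exp_zero, mul_one] at this
  exact this

/-- The Fourier transform `∫ h(x) exp(-iωx) dx` in the normalisation used for the density. -/
def ft (h : ℝ → ℝ) (ω : ℝ) : ℂ := ∫ x : ℝ, (h x : ℂ) * Complex.exp (-(Complex.I * ω * x))

/-- The exponential probability density `(c/2) exp(-c|t|)`. -/
def expKernel (c t : ℝ) : ℝ := c / 2 * Real.exp (-(c * |t|))

theorem norm_cexp_I_mul (ω x : ℝ) : ‖Complex.exp (Complex.I * ω * x)‖ = 1 := by
  rw [show Complex.I * ω * x = ((ω * x : ℝ) : ℂ) * Complex.I by push_cast; ring]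
  exact Complex.norm_exp_ofReal_mul_I _

theorem norm_cexp_neg_I_mul (ω x : ℝ) : ‖Complex.exp (-(Complex.I * ω * x))‖ = 1 := by
  rw [show -(Complex.I * ω * x) = ((-(ω * x) : ℝ) : ℂ) * Complex.I by push_cast; ring]
  exact Complex.norm_exp_ofReal_mul_I _

theorem integrable_expKernel {c : ℝ} (hc : 0 < c) : Integrable (expKernel c) :=
  (integrable_exp_neg_abs hc).const_mul _

theorem ft_expKernel {c : ℝ} (hc : 0 < c) (ω : ℝ) :
    ft (expKernel c) ω = ((c ^ 2 / (ω ^ 2 + c ^ 2) : ℝ) : ℂ) := by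
  have h := integral_exp_neg_abs_mul_cexp (c := c) (z := -(Complex.I * ω)) (by simpa using hc)
  have h' : ft (expKernel c) ω = (c / 2 : ℂ) *
      ∫ x : ℝ, ((Real.exp (-(c * |x|)) : ℝ) : ℂ) * Complex.exp (-(Complex.I * ω) * x) := by
    rw [ft, ← integral_const_mul]
    refine integral_congr_ae (Eventually.of_forall fun x => ?_)
    simp only [expKernel]
    push_cast
    ring_nf
  rw [h', h]
  have h1 : ((ω ^ 2 + c ^ 2 : ℝ) : ℂ) ≠ 0 := by
    exact_mod_cast (by positivity : ω ^ 2 + c ^ 2 ≠ 0)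
  have h2 : (c : ℂ) ^ 2 - (-(Complex.I * ω)) ^ 2 = ((ω ^ 2 + c ^ 2 : ℝ) : ℂ) := by
    push_cast
    ring_nf
    rw [Complex.I_sq]
    ring
  rw [h2]
  push_cast at h1 ⊢
  field_simp

theorem integrable_ft_mul_cexp {H : ℝ → ℂ} (hH : Integrable H) (x : ℝ) :
    Integrable fun ω : ℝ => H ω * Complex.exp (Complex.I * ω * x) := by
  refine hH.mul_bdd (c := 1) ?_ (Eventually.of_forall fun ω => (norm_cexp_I_mul ω x).le)
  exact (by fun_prop : Continuous fun ω : ℝ => Complex.exp (Complex.I * ω * x)).aestronglyMeasurable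

theorem continuous_integral_mul_cexp {H : ℝ → ℂ} (hH : Integrable H) :
    Continuous fun x : ℝ => ∫ ω : ℝ, H ω * Complex.exp (Complex.I * ω * x) := by
  refine continuous_of_dominated (bound := fun ω => ‖H ω‖)
    (fun x => (integrable_ft_mul_cexp hH x).aestronglyMeasurable) ?_ hH.norm ?_
  · intro x
    refine Eventually.of_forall fun ω => ?_
    rw [norm_mul, norm_cexp_I_mul, mul_one]
  · exact Eventually.of_forall fun ω => by fun_prop

/-- Convolution with an integrable kernel acts on inverse Fourier transforms as a multiplier. -/
theorem integral_kernel_mul_inverse {k : ℝ → ℝ} (hk : Integrable k) {H : ℝ → ℂ}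
    (hH : Integrable H) (x : ℝ) :
    ∫ z : ℝ, (k (x - z) : ℂ) * ∫ ω : ℝ, H ω * Complex.exp (Complex.I * ω * z)
      = ∫ ω : ℝ, H ω * ft k ω * Complex.exp (Complex.I * ω * x) := by
  have hk' : Integrable fun z : ℝ => (k (x - z) : ℂ) := (hk.comp_sub_left x).ofReal
  have hprod : Integrable (Function.uncurry fun z ω : ℝ =>
      (k (x - z) : ℂ) * (H ω * Complex.exp (Complex.I * ω * z))) (volume.prod volume) := by
    have h1 := hk'.mul_prod hH
    have h2 : Integrable (fun p : ℝ × ℝ => ((k (x - p.1) : ℂ) * H p.2) *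
        Complex.exp (Complex.I * p.2 * p.1)) (volume.prod volume) := by
      refine h1.mul_bdd (c := 1) ?_ (Eventually.of_forall fun p => (norm_cexp_I_mul p.2 p.1).le)
      exact (by fun_prop : Continuous fun p : ℝ × ℝ =>
        Complex.exp (Complex.I * p.2 * p.1)).aestronglyMeasurable
    refine h2.congr (Eventually.of_forall fun p => ?_)
    simp only [Function.uncurry]
    ring
  calc ∫ z : ℝ, (k (x - z) : ℂ) * ∫ ω : ℝ, H ω * Complex.exp (Complex.I * ω * z)
      = ∫ z : ℝ, ∫ ω : ℝ, (k (x - z) : ℂ) * (H ω * Complex.exp (Complex.I * ω * z)) := by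
        simp_rw [integral_const_mul]
    _ = ∫ ω : ℝ, ∫ z : ℝ, (k (x - z) : ℂ) * (H ω * Complex.exp (Complex.I * ω * z)) :=
        integral_integral_swap hprod
    _ = _ := by
        refine integral_congr_ae (Eventually.of_forall fun ω => ?_)
        simp only
        rw [ft, ← integral_sub_left_eq_self (fun t : ℝ => (k t : ℂ) *
          Complex.exp (-(Complex.I * ω * t))) _ x, mul_assoc, ← integral_mul_const,
          ← integral_const_mul]
        refine integral_congr_ae (Eventually.of_forall fun z => ?_)
        simp only
        have : Complex.exp (-(Complex.I * ω * ((x - z : ℝ) : ℂ))) * Complex.exp (Complex.I * ω * x)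
            = Complex.exp (Complex.I * ω * z) := by
          rw [← Complex.exp_add]
          push_cast
          ring_nf
        rw [mul_assoc (k (x - z) : ℂ), this]
        ring

/-- Mathlib's inversion theorem in the normalisation of `ft`. -/
theorem fourier_inversion {h : ℝ → ℝ} (hc : Continuous h) (hi : Integrable h)
    (hft : Integrable (ft h)) (x : ℝ) :
    ∫ ω : ℝ, ft h ω * Complex.exp (Complex.I * ω * x) = 2 * Real.pi * h x := by
  open scoped FourierTransform in
  have hF : ∀ ξ : ℝ, 𝓕 (fun x => (h x : ℂ)) ξ = ft h (2 * Real.pi * ξ) := by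
    intro ξ
    rw [Real.fourier_real_eq_integral_exp_smul, ft]
    refine integral_congr_ae (Eventually.of_forall fun y => ?_)
    simp only [smul_eq_mul]
    rw [mul_comm]
    congr 2
    push_cast
    ring
  open scoped FourierTransform in
  have hFi : Integrable (𝓕 (fun x => (h x : ℂ))) := by
    rw [show (𝓕 (fun x => (h x : ℂ))) = fun ξ => ft h (2 * Real.pi * ξ) from funext hF]
    exact hft.comp_mul_left' (by positivity)
  open scoped FourierTransform in
  have hinv := congrFun ((Complex.continuous_ofReal.comp hc).fourierInv_fourier_eq
    (f := fun x => (h x : ℂ)) hi.ofReal hFi) x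
  rw [Real.fourierInv_eq'] at hinv
  have : ∫ ξ : ℝ, ft h (2 * Real.pi * ξ) * Complex.exp (Complex.I * ((2 * Real.pi * ξ : ℝ) : ℂ) * x)
      = h x := by
    rw [← hinv]
    refine integral_congr_ae (Eventually.of_forall fun y => ?_)
    simp only [smul_eq_mul]
    rw [hF, mul_comm]
    congr 2
    simp
    ring
  have hs := Measure.integral_comp_mul_left
    (fun ω : ℝ => ft h ω * Complex.exp (Complex.I * ω * x)) (2 * Real.pi)
  rw [abs_of_pos (by positivity), this] at hs
  rw [eq_comm, inv_smul_eq_iff₀ (by positivity)] at hs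
  rw [hs, Complex.real_smul]
  push_cast
  ring

/-! ### Partial fractions of the hyperbolic cotangent and tangent -/

/-- The expansion of `u coth u`, from that of the cotangent at `iu/π`. -/
theorem hasSum_coth_partial_fractions {u : ℝ} (hu : u ≠ 0) :
    HasSum (fun n : ℕ => 2 * u ^ 2 / (u ^ 2 + Real.pi ^ 2 * ((n : ℝ) + 1) ^ 2))
      (u / Real.tanh u - 1) := by
  have hpi : (Real.pi : ℂ) ≠ 0 := by exact_mod_cast Real.pi_ne_zero
  have huC : (u : ℂ) ≠ 0 := by exact_mod_cast hu
  set x : ℂ := Complex.I * u / Real.pi with hx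
  have hx0 : x ≠ 0 := by
    rw [hx]
    exact div_ne_zero (mul_ne_zero Complex.I_ne_zero huC) hpi
  have hxZ : x ∈ Complex.integerComplement := by
    rintro ⟨n, hn⟩
    have := congrArg Complex.im hn
    rw [hx, show Complex.I * (u : ℂ) / Real.pi = ((u / Real.pi : ℝ) : ℂ) * Complex.I by
      push_cast; ring] at this
    simp only [Complex.intCast_im, Complex.im_ofReal_mul, Complex.I_im,
      mul_one] at this
    exact div_ne_zero hu Real.pi_ne_zero this.symm
  have h := (summable_cotTerm hxZ).hasSum
  rw [← cot_series_rep' hxZ] at h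
  have h2 := h.mul_left x
  have e1 : x * (Real.pi * Complex.cot (Real.pi * x) - 1 / x) = ((u / Real.tanh u - 1 : ℝ) :
      ℂ) := by
    have : (Real.pi : ℂ) * x = u * Complex.I := by
      rw [hx]; field_simp
    rw [mul_sub, mul_one_div_cancel hx0, ← mul_assoc, mul_comm x, this, Complex.cot_eq_cos_div_sin,
      Complex.cos_mul_I, Complex.sin_mul_I]
    push_cast
    rw [Complex.tanh_eq_sinh_div_cosh]
    have hs : Complex.sinh u ≠ 0 := by
      rw [← Complex.ofReal_sinh]
      exact_mod_cast fun h => hu (Real.sinh_eq_zero.1 h)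
    have := Complex.I_ne_zero
    field_simp
  rw [e1] at h2
  have e2 : (fun n : ℕ => x * cotTerm x n) = fun n : ℕ =>
      ((2 * u ^ 2 / (u ^ 2 + Real.pi ^ 2 * ((n : ℝ) + 1) ^ 2) : ℝ) : ℂ) := by
    funext n
    rw [cotTerm_identity hxZ]
    have hd : (u ^ 2 + Real.pi ^ 2 * ((n : ℝ) + 1) ^ 2 : ℝ) ≠ 0 := by positivity
    have hd' : ((u ^ 2 + Real.pi ^ 2 * ((n : ℝ) + 1) ^ 2 : ℝ) : ℂ) ≠ 0 := by exact_mod_cast hd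
    have hxx : x ^ 2 = -(u ^ 2 / Real.pi ^ 2) := by
      rw [hx, div_pow, mul_pow, Complex.I_sq]; ring
    have e3 : (x + (n + 1)) * (x - (n + 1)) =
        -(((u ^ 2 + Real.pi ^ 2 * ((n : ℝ) + 1) ^ 2 : ℝ) : ℂ) / Real.pi ^ 2) := by
      rw [show (x + ((n : ℂ) + 1)) * (x - (n + 1)) = x ^ 2 - (n + 1) ^ 2 by ring, hxx]
      push_cast
      field_simp
      ring
    rw [e3, show x * (2 * x * (1 / -(((u ^ 2 + Real.pi ^ 2 * ((n : ℝ) + 1) ^ 2 : ℝ) : ℂ)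
      / Real.pi ^ 2))) = 2 * x ^ 2 * (1 / -(((u ^ 2 + Real.pi ^ 2 * ((n : ℝ) + 1) ^ 2 : ℝ) : ℂ)
      / Real.pi ^ 2)) by ring, hxx]
    push_cast at hd' ⊢
    field_simp
  rw [e2] at h2
  exact_mod_cast h2

/-- The expansion of `u tanh u`, from that of the hyperbolic cotangent and
`tanh u = 2 coth(2u) - coth u`, which cancels the terms of even index. -/
theorem hasSum_tanh_partial_fractions {u : ℝ} (hu : u ≠ 0) :
    HasSum (fun k : ℕ => 8 * u ^ 2 / (4 * u ^ 2 + Real.pi ^ 2 * (2 * (k : ℝ) + 1) ^ 2))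
      (u * Real.tanh u) := by
  have h1 := hasSum_coth_partial_fractions (u := 2 * u) (by simpa using hu)
  have h2 := hasSum_coth_partial_fractions hu
  set f : ℕ → ℝ := fun n => 2 * (2 * u) ^ 2 / ((2 * u) ^ 2 + Real.pi ^ 2 * ((n : ℝ) + 1) ^ 2)
    with hf
  have ho : HasSum (fun k : ℕ => f (2 * k + 1)) (u / Real.tanh u - 1) := by
    refine h2.congr_fun fun k => ?_
    simp only [hf]
    push_cast
    have : 0 < u ^ 2 := by positivity
    rw [div_eq_div_iff (by positivity) (by positivity)]
    ring
  have he : Summable (fun k : ℕ => f (2 * k)) :=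
    h1.summable.comp_injective (fun a b h => by simpa using h)
  have h3 := (he.hasSum.even_add_odd ho).unique h1
  have h4 : ∑' k : ℕ, f (2 * k) = u * Real.tanh u := by
    have hs : Real.sinh u ≠ 0 := fun h => hu (Real.sinh_eq_zero.1 h)
    have hc : Real.cosh u ≠ 0 := (Real.cosh_pos u).ne'
    have h5 : 2 * u / Real.tanh (2 * u) = u * Real.tanh u + u / Real.tanh u := by
      rw [Real.tanh_eq_sinh_div_cosh, Real.tanh_eq_sinh_div_cosh, Real.sinh_two_mul,
        Real.cosh_two_mul]
      field_simp
      ring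
    linarith
  rw [← h4]
  refine he.hasSum.congr_fun fun k => ?_
  simp only [hf]
  push_cast
  ring

/-! ### The Green kernel of the strip on the real axis -/

/-- The Green function of the strip with both arguments on the real axis, `-log |tanh(πt/(4d))|`
(`Real.log` is even, so no absolute value is needed); at `t = 0` it takes the value `0`. -/
def green (d t : ℝ) : ℝ := -Real.log (tanhStrip d t)

/-- The `k`-th term of the expansion of the Green kernel in exponentials. -/
def greenTerm (d : ℝ) (k : ℕ) (t : ℝ) : ℝ :=
  2 / (2 * (k : ℝ) + 1) * Real.exp (-((2 * (k : ℝ) + 1) * (Real.pi / (2 * d)) * |t|))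

theorem tanhStrip_neg (d t : ℝ) : tanhStrip d (-t) = -tanhStrip d t := by
  rw [tanhStrip, mul_neg, Real.tanh_neg, tanhStrip]

theorem green_neg (d t : ℝ) : green d (-t) = green d t := by
  rw [green, tanhStrip_neg, Real.log_neg_eq_log, green]

theorem green_abs (d t : ℝ) : green d |t| = green d t := by
  rcases abs_choice t with h | h <;> rw [h]
  exact green_neg d t

/-- With `y = exp(-π|t|/(2d))` the kernel is `log((1 + y) / (1 - y))`. -/
theorem hasSum_green {d : ℝ} (hd : 0 < d) {t : ℝ} (ht : t ≠ 0) :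
    HasSum (fun k => greenTerm d k t) (green d t) := by
  have hpi := Real.pi_pos
  have ht' : 0 < |t| := abs_pos.2 ht
  set y := Real.exp (-(Real.pi / (2 * d) * |t|)) with hy
  have hy0 : 0 < y := Real.exp_pos _
  have hy1 : y < 1 := by
    rw [hy, Real.exp_lt_one_iff]
    have : 0 < Real.pi / (2 * d) * |t| := by positivity
    linarith
  have h := Real.hasSum_log_sub_log_of_abs_lt_one (x := y) (by rwa [abs_of_pos hy0])
  have e : green d t = Real.log (1 + y) - Real.log (1 - y) := by
    rw [← green_abs, green, tanhStrip, ← Real.log_div (by linarith) (by linarith), ← Real.log_inv]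
    congr 1
    rw [Real.tanh_eq_sinh_div_cosh, Real.sinh_eq, Real.cosh_eq]
    set u := Real.pi / (4 * d) * |t| with hu
    have hyu : y = Real.exp (-u) ^ 2 := by
      rw [hy, hu, ← Real.exp_nat_mul]
      congr 1
      push_cast
      field_simp
      ring
    have he : Real.exp u = (Real.exp (-u))⁻¹ := by rw [Real.exp_neg, inv_inv]
    have hp : 0 < Real.exp (-u) := Real.exp_pos _
    rw [hyu] at hy1
    rw [hyu, he]
    have h1 : 1 - Real.exp (-u) ^ 2 ≠ 0 := by linarith
    have h2 : (Real.exp (-u))⁻¹ - Real.exp (-u) ≠ 0 := by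
      intro h0
      field_simp at h0
      exact h1 (by simpa using h0)
    field_simp
  rw [e]
  refine h.congr_fun fun k => ?_
  rw [greenTerm, hy, ← Real.exp_nat_mul]
  push_cast
  ring_nf

theorem integrable_greenTerm {d : ℝ} (hd : 0 < d) (k : ℕ) : Integrable (greenTerm d k) :=
  (integrable_exp_neg_abs (by positivity)).const_mul _

theorem measurable_green (d : ℝ) : Measurable (green d) := by
  have h : Continuous (tanhStrip d) := by
    unfold tanhStrip
    simp only [Real.tanh_eq_sinh_div_cosh]
    exact Continuous.div (by fun_prop) (by fun_prop) fun x => (Real.cosh_pos _).ne'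
  exact (Real.measurable_log.comp h.measurable).neg

theorem ae_ne_zero : ∀ᵐ t : ℝ, t ≠ 0 := by
  simp [ae_iff]

theorem tsum_greenTerm_ae {d : ℝ} (hd : 0 < d) :
    (fun t => ∑' k, greenTerm d k t) =ᵐ[volume] green d := by
  filter_upwards [ae_ne_zero] with t ht
  exact (hasSum_green hd ht).tsum_eq

theorem ft_greenTerm {d : ℝ} (hd : 0 < d) (k : ℕ) (ω : ℝ) :
    ft (greenTerm d k) ω = ((4 * (Real.pi / (2 * d)) /
      (((2 * (k : ℝ) + 1) * (Real.pi / (2 * d))) ^ 2 + ω ^ 2) : ℝ) : ℂ) := by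
  set c := (2 * (k : ℝ) + 1) * (Real.pi / (2 * d)) with hc
  have hpi := Real.pi_pos
  have hc0 : 0 < c := by positivity
  have h := ft_expKernel hc0 ω
  have e : ft (greenTerm d k) ω = ((4 / (c * (2 * (k : ℝ) + 1)) : ℝ) : ℂ) * ft (expKernel c) ω := by
    rw [ft, ft, ← integral_const_mul]
    refine integral_congr_ae (Eventually.of_forall fun x => ?_)
    simp only [greenTerm, expKernel]
    rw [← mul_assoc, ← Complex.ofReal_mul]
    congr 2
    rw [← hc]
    field_simp
    norm_num
  rw [e, h, ← Complex.ofReal_mul]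
  congr 1
  rw [show 4 * (Real.pi / (2 * d)) = 4 * c / (2 * (k : ℝ) + 1) by rw [hc]; field_simp]
  field_simp
  ring

theorem integral_greenTerm {d : ℝ} (hd : 0 < d) (k : ℕ) :
    ∫ t, greenTerm d k t = 4 * (Real.pi / (2 * d)) /
      (((2 * (k : ℝ) + 1) * (Real.pi / (2 * d))) ^ 2) := by
  have h := ft_greenTerm hd k 0
  simp only [ft, Complex.ofReal_zero, mul_zero, zero_mul, neg_zero, Complex.exp_zero, mul_one] at h
  rw [integral_complex_ofReal] at h
  have := Complex.ofReal_injective h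
  simpa using this

theorem hasSum_odd_inv_sq : HasSum (fun k : ℕ => 1 / (2 * (k : ℝ) + 1) ^ 2) (Real.pi ^ 2 / 8) := by
  have h := hasSum_zeta_two
  set f : ℕ → ℝ := fun n => 1 / (n : ℝ) ^ 2 with hf
  have he : HasSum (fun k : ℕ => f (2 * k)) (Real.pi ^ 2 / 24) := by
    have := h.mul_left (1 / 4)
    rw [show (1 / 4 : ℝ) * (Real.pi ^ 2 / 6) = Real.pi ^ 2 / 24 by ring] at this
    refine this.congr_fun fun k => ?_
    simp only [hf]
    push_cast
    rw [mul_pow, one_div, one_div, mul_inv]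
    norm_num
  have ho : HasSum (fun k : ℕ => f (2 * k + 1)) (∑' k : ℕ, f (2 * k + 1)) :=
    (h.summable.comp_injective (i := fun k : ℕ => 2 * k + 1)
      (fun a b h => by simpa using h)).hasSum
  have hsum := (he.even_add_odd ho).unique h
  rw [show ∑' k : ℕ, f (2 * k + 1) = Real.pi ^ 2 / 8 by linarith] at ho
  refine ho.congr_fun fun k => ?_
  simp only [hf]
  push_cast
  rfl

theorem hasSum_integral_greenTerm {d : ℝ} (hd : 0 < d) :
    HasSum (fun k => ∫ t, greenTerm d k t) (Real.pi * d) := by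
  have hpi := Real.pi_pos
  have h := hasSum_odd_inv_sq.mul_left (8 * d / Real.pi)
  rw [show 8 * d / Real.pi * (Real.pi ^ 2 / 8) = Real.pi * d by field_simp] at h
  refine h.congr_fun fun k => ?_
  rw [integral_greenTerm hd]
  have : (2 * (k : ℝ) + 1) ≠ 0 := by positivity
  field_simp
  ring

theorem greenTerm_nonneg (d : ℝ) (k : ℕ) (t : ℝ) : 0 ≤ greenTerm d k t := by
  unfold greenTerm; positivity

theorem integral_green {d : ℝ} (hd : 0 < d) : ∫ t, green d t = Real.pi * d := by
  rw [← integral_congr_ae (tsum_greenTerm_ae hd)]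
  refine (hasSum_integral_of_summable_integral_norm (integrable_greenTerm hd) ?_).unique
    (hasSum_integral_greenTerm hd)
  simp only [Real.norm_of_nonneg (greenTerm_nonneg d _ _)]
  exact (hasSum_integral_greenTerm hd).summable

/-- A function with nonzero Bochner integral is integrable. -/
theorem integrable_green {d : ℝ} (hd : 0 < d) : Integrable (green d) := by
  by_contra h
  have h1 := integral_green hd
  rw [integral_undef h] at h1
  exact (mul_pos Real.pi_pos hd).ne h1

/-- Away from zero frequency the Green kernel has Fourier transform `(π/ω) tanh(dω)`. -/
theorem ft_green {d : ℝ} (hd : 0 < d) {ω : ℝ} (hω : ω ≠ 0) :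
    ft (green d) ω = ((Real.pi / ω * Real.tanh (d * ω) : ℝ) : ℂ) := by
  have hpi := Real.pi_pos
  have h1 : HasSum (fun k => ft (greenTerm d k) ω)
      (∫ t, ∑' k, (greenTerm d k t : ℂ) * Complex.exp (-(Complex.I * ω * t))) := by
    refine hasSum_integral_of_summable_integral_norm (fun k => ?_) ?_
    · refine (integrable_greenTerm hd k).ofReal.mul_bdd (c := 1) ?_
        (Eventually.of_forall fun t => (norm_cexp_neg_I_mul ω t).le)
      exact (by fun_prop : Continuous fun t : ℝ =>
        Complex.exp (-(Complex.I * ω * t))).aestronglyMeasurable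
    · simp only [norm_mul, norm_cexp_neg_I_mul, mul_one, Complex.norm_real,
        Real.norm_of_nonneg (greenTerm_nonneg d _ _)]
      exact (hasSum_integral_greenTerm hd).summable
  have h2 : ∫ t, ∑' k, (greenTerm d k t : ℂ) * Complex.exp (-(Complex.I * ω * t)) =
      ft (green d) ω := by
    rw [ft]
    refine integral_congr_ae ?_
    filter_upwards [ae_ne_zero] with t ht
    rw [tsum_mul_right, ← Complex.ofReal_tsum, (hasSum_green hd ht).tsum_eq]
  rw [h2] at h1
  refine h1.unique ?_
  have hu : d * ω ≠ 0 := mul_ne_zero hd.ne' hω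
  have h3 := (hasSum_tanh_partial_fractions hu).mul_left (Real.pi / (d * ω ^ 2))
  rw [show Real.pi / (d * ω ^ 2) * (d * ω * Real.tanh (d * ω)) = Real.pi / ω * Real.tanh (d * ω) by
    field_simp] at h3
  refine (Complex.hasSum_ofReal.2 h3).congr_fun fun k => ?_
  rw [ft_greenTerm hd]
  congr 1
  have hk : (2 * (k : ℝ) + 1) ≠ 0 := by positivity
  have : 0 < ω ^ 2 := by positivity
  field_simp
  ring

theorem green_nonneg {d : ℝ} (t : ℝ) : 0 ≤ green d t := by
  rw [green, neg_nonneg, ← Real.log_abs]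
  refine Real.log_nonpos (abs_nonneg _) ?_
  exact (Real.abs_tanh_lt_one _).le

theorem tanhStrip_strictMono {d : ℝ} (hd : 0 < d) : StrictMono (tanhStrip d) := by
  intro s t hst
  have hpi := Real.pi_pos
  refine (Real.artanh_lt_artanh_iff (Real.tanh_bijOn.mapsTo (Set.mem_univ _))
    (Real.tanh_bijOn.mapsTo (Set.mem_univ _))).1 ?_
  rw [Real.artanh_tanh, Real.artanh_tanh]
  exact mul_lt_mul_of_pos_left hst (by positivity)

theorem tanhStrip_zero (d : ℝ) : tanhStrip d 0 = 0 := by simp [tanhStrip]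

theorem tanhStrip_pos {d t : ℝ} (hd : 0 < d) (ht : 0 < t) : 0 < tanhStrip d t := by
  simpa [tanhStrip_zero] using tanhStrip_strictMono hd ht

theorem green_anti {d : ℝ} (hd : 0 < d) {s t : ℝ} (hs : s ≠ 0) (hst : |s| ≤ |t|) :
    green d t ≤ green d s := by
  rw [← green_abs, ← green_abs d s, green, green, neg_le_neg_iff]
  exact Real.log_le_log (tanhStrip_pos hd (abs_pos.2 hs)) ((tanhStrip_strictMono hd).monotone hst)

/-! ### The logarithm of the weight -/

/-- `log w` on the real line. -/
def logWeight (w : ℂ → ℂ) (x : ℝ) : ℝ := Real.log (realPart w x)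

theorem ofReal_mem_strip {d : ℝ} (hd : 0 < d) (x : ℝ) : (x : ℂ) ∈ strip d := by
  simpa [strip] using hd

theorem isOpen_strip (d : ℝ) : IsOpen (strip d) :=
  isOpen_lt (Complex.continuous_im.abs) continuous_const

theorem hasDerivAt_realPart {d : ℝ} {w : ℂ → ℂ} (hd : 0 < d) (hw : IsWeight d w) (x : ℝ) :
    HasDerivAt (realPart w) (deriv w x).re x :=
  (hw.memB.analytic.differentiableAt
    ((isOpen_strip d).mem_nhds (ofReal_mem_strip hd x))).hasDerivAt.real_of_complex

theorem hasDerivAt_logWeight {d : ℝ} {w : ℂ → ℂ} (hd : 0 < d) (hw : IsWeight d w) (x : ℝ) :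
    HasDerivAt (logWeight w) (logDerivReal w x) x := by
  have h := hasDerivAt_realPart hd hw x
  have h2 := h.log (hw.real_pos x).2.ne'
  rwa [← h.deriv] at h2

theorem continuous_logWeight {d : ℝ} {w : ℂ → ℂ} (hd : 0 < d) (hw : IsWeight d w) :
    Continuous (logWeight w) :=
  continuous_iff_continuousAt.2 fun x => (hasDerivAt_logWeight hd hw x).continuousAt

theorem continuous_logDerivReal {d : ℝ} {w : ℂ → ℂ} (hd : 0 < d) (hw : IsWeight d w) :
    Continuous (logDerivReal w) := by
  have h1 : deriv (realPart w) = fun x : ℝ => (deriv w x).re :=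
    funext fun x => (hasDerivAt_realPart hd hw x).deriv
  have h2 : ContinuousOn (deriv w) (strip d) :=
    (hw.memB.analytic.deriv (isOpen_strip d)).continuousOn
  have h3 : Continuous fun x : ℝ => (deriv w x).re :=
    Complex.continuous_re.comp (h2.comp_continuous Complex.continuous_ofReal (ofReal_mem_strip hd))
  have h4 : Continuous (realPart w) :=
    continuous_iff_continuousAt.2 fun x => (hasDerivAt_realPart hd hw x).continuousAt
  unfold logDerivReal
  rw [h1]
  exact h3.div h4 fun x => (hw.real_pos x).2.ne'

theorem logWeight_neg {d : ℝ} {w : ℂ → ℂ} (hw : IsWeight d w) (x : ℝ) :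
    logWeight w (-x) = logWeight w x := by
  rw [logWeight, logWeight, realPart, realPart, hw.even]

theorem logDerivReal_neg {d : ℝ} {w : ℂ → ℂ} (hd : 0 < d) (hw : IsWeight d w) (x : ℝ) :
    logDerivReal w (-x) = -logDerivReal w x := by
  have h := (hasDerivAt_logWeight hd hw (-x)).scomp x (hasDerivAt_neg x)
  have h2 : logWeight w ∘ Neg.neg = logWeight w := funext fun y => logWeight_neg hw y
  rw [h2] at h
  have := h.unique (hasDerivAt_logWeight hd hw x)
  simp only [smul_eq_mul] at this
  linarith

theorem logWeight_le_tangent {d : ℝ} {w : ℂ → ℂ} (hd : 0 < d) (hw : IsWeight d w) (x y : ℝ) :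
    logWeight w y ≤ logWeight w x + logDerivReal w x * (y - x) := by
  have hc : ConcaveOn ℝ Set.univ (logWeight w) := hw.concave
  have hder := hasDerivAt_logWeight hd hw x
  rcases lt_trichotomy x y with h | rfl | h
  · have := hc.slope_le_of_hasDerivAt (Set.mem_univ x) (Set.mem_univ y) h hder
    rw [slope_def_field, div_le_iff₀ (by linarith)] at this
    linarith
  · simp
  · have := hc.le_slope_of_hasDerivAt (Set.mem_univ y) (Set.mem_univ x) h hder
    rw [slope_def_field, le_div_iff₀ (by linarith)] at this
    linarith

theorem logDerivReal_antitone {d : ℝ} {w : ℂ → ℂ} (hd : 0 < d) (hw : IsWeight d w) :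
    Antitone (logDerivReal w) := by
  intro x y hxy
  rcases hxy.eq_or_lt with rfl | h
  · rfl
  · have h1 := logWeight_le_tangent hd hw x y
    have h2 := logWeight_le_tangent hd hw y x
    nlinarith

theorem logDerivReal_nonpos {d : ℝ} {w : ℂ → ℂ} (hd : 0 < d) (hw : IsWeight d w) {x : ℝ}
    (hx : 0 ≤ x) : logDerivReal w x ≤ 0 := by
  have h1 := logDerivReal_antitone hd hw hx
  have h2 := logDerivReal_neg hd hw 0
  rw [neg_zero] at h2
  linarith

/-! ### The potential of the density -/

/-- The prescribed Green potential of the density: `log w + K` on `[-α, α]`, continued outside by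
a multiple of `exp(-π(|x| - α)/(2d))`, so that it is continuously differentiable. The two
branches are encoded by `min |x| α` and `max (|x| - α) 0`. -/
def potential (d : ℝ) (w : ℂ → ℂ) (α x : ℝ) : ℝ :=
  (logWeight w (min |x| α) - logWeight w α) +
    -(2 * d / Real.pi * logDerivReal w α) * Real.exp (-(Real.pi / (2 * d) * max (|x| - α) 0))

theorem logWeight_abs {d : ℝ} {w : ℂ → ℂ} (hw : IsWeight d w) (x : ℝ) :
    logWeight w |x| = logWeight w x := by
  rcases abs_choice x with h | h <;> rw [h]
  exact logWeight_neg hw x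

theorem potential_of_abs_le {d : ℝ} {w : ℂ → ℂ} (hw : IsWeight d w) {α x : ℝ} (hx : |x| ≤ α) :
    potential d w α x = logWeight w x + rateK d w α := by
  rw [potential, min_eq_left hx, max_eq_right (by linarith), logWeight_abs hw, rateK]
  simp only [mul_zero, neg_zero, Real.exp_zero, mul_one, logWeight]
  ring

theorem potential_of_le_abs {d : ℝ} {w : ℂ → ℂ} {α x : ℝ} (hx : α ≤ |x|) :
    potential d w α x =
      -(2 * d / Real.pi * logDerivReal w α) * Real.exp (-(Real.pi / (2 * d) * (|x| - α))) := by
  rw [potential, min_eq_right hx, max_eq_left (by linarith), sub_self, zero_add]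

theorem potential_neg (d : ℝ) (w : ℂ → ℂ) (α x : ℝ) :
    potential d w α (-x) = potential d w α x := by
  rw [potential, abs_neg, potential]

theorem continuous_potential {d : ℝ} {w : ℂ → ℂ} (hd : 0 < d) (hw : IsWeight d w) (α : ℝ) :
    Continuous (potential d w α) := by
  have := continuous_logWeight hd hw
  unfold potential
  fun_prop

theorem neg_mul_logDerivReal_nonneg {d : ℝ} {w : ℂ → ℂ} (hd : 0 < d) (hw : IsWeight d w) {α : ℝ}
    (hα : 0 < α) : 0 ≤ -(2 * d / Real.pi * logDerivReal w α) := by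
  have h1 := logDerivReal_nonpos hd hw hα.le
  have h2 : 0 < 2 * d / Real.pi := by have := Real.pi_pos; positivity
  nlinarith

/-- The first summand of `potential` is supported on `[-α, α]`. -/
theorem potential_bump_eq_zero {w : ℂ → ℂ} {α x : ℝ} (hx : x ∉ Set.Ioc (-α) α) :
    logWeight w (min |x| α) - logWeight w α = 0 := by
  have : α ≤ |x| := by
    by_contra! h
    exact hx ⟨(abs_lt.1 h).1, (abs_lt.1 h).2.le⟩
  rw [min_eq_right this, sub_self]

theorem integrable_potential_bump {d : ℝ} {w : ℂ → ℂ} (hd : 0 < d) (hw : IsWeight d w) (α : ℝ) :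
    Integrable fun x => logWeight w (min |x| α) - logWeight w α := by
  have := continuous_logWeight hd hw
  refine Continuous.integrable_of_hasCompactSupport (by fun_prop) ?_
  refine HasCompactSupport.intro (isCompact_Icc (a := -α) (b := α)) fun x hx => ?_
  exact potential_bump_eq_zero fun h => hx (Set.Ioc_subset_Icc_self h)

theorem integrable_exp_neg_max {b α : ℝ} (hb : 0 < b) :
    Integrable fun x : ℝ => Real.exp (-(b * max (|x| - α) 0)) := by
  refine ((integrable_exp_neg_abs hb).const_mul (Real.exp (b * α))).mono'
    (by fun_prop : Continuous _).aestronglyMeasurable (Eventually.of_forall fun x => ?_)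
  rw [Real.norm_of_nonneg (Real.exp_pos _).le, ← Real.exp_add]
  refine Real.exp_le_exp.2 ?_
  have : |x| - α ≤ max (|x| - α) 0 := le_max_left _ _
  nlinarith

theorem integrable_potential {d : ℝ} {w : ℂ → ℂ} (hd : 0 < d) (hw : IsWeight d w) (α : ℝ) :
    Integrable (potential d w α) :=
  (integrable_potential_bump hd hw α).add
    ((integrable_exp_neg_max (by have := Real.pi_pos; positivity)).const_mul _)

theorem Integrable.mul_cexp {h : ℝ → ℝ} (hh : Integrable h) (ω : ℝ) :
    Integrable fun x : ℝ => (h x : ℂ) * Complex.exp (-(Complex.I * ω * x)) := by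
  refine hh.ofReal.mul_bdd (c := 1) ?_ (Eventually.of_forall fun x => (norm_cexp_neg_I_mul ω x).le)
  exact (by fun_prop : Continuous fun x : ℝ =>
      Complex.exp (-(Complex.I * ω * x))).aestronglyMeasurable

/-- Integration by parts: the bump vanishes at the end points. -/
theorem ft_potential_bump {d : ℝ} {w : ℂ → ℂ} (hd : 0 < d) (hw : IsWeight d w) {α ω : ℝ}
    (hα : 0 < α) (hω : ω ≠ 0) :
    ft (fun x => logWeight w (min |x| α) - logWeight w α) ω = 1 / (Complex.I * ω) *
      ∫ x in (-α)..α, (logDerivReal w x : ℂ) * Complex.exp (-(Complex.I * ω * x)) := by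
  have hωC : Complex.I * ω ≠ 0 := mul_ne_zero Complex.I_ne_zero (by exact_mod_cast hω)
  have h1 : ft (fun x => logWeight w (min |x| α) - logWeight w α) ω =
      ∫ x in (-α)..α, ((logWeight w x - logWeight w α : ℝ) : ℂ) *
        Complex.exp (-(Complex.I * ω * x)) := by
    rw [ft, ← setIntegral_eq_integral_of_forall_compl_eq_zero (s := Set.Ioc (-α) α),
      intervalIntegral.integral_of_le (by linarith)]
    · refine setIntegral_congr_fun measurableSet_Ioc fun x hx => ?_
      rw [min_eq_left (abs_le.2 ⟨hx.1.le, hx.2⟩), logWeight_abs hw]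
    · intro x hx
      rw [potential_bump_eq_zero hx]
      simp
  have hu : ∀ x ∈ Set.uIcc (-α) α, HasDerivAt
      (fun x : ℝ => ((logWeight w x - logWeight w α : ℝ) : ℂ)) (logDerivReal w x : ℂ) x :=
    fun x _ => ((hasDerivAt_logWeight hd hw x).sub_const _).ofReal_comp
  have hv : ∀ x ∈ Set.uIcc (-α) α, HasDerivAt
      (fun x : ℝ => -(1 / (Complex.I * ω)) * Complex.exp (-(Complex.I * ω * x)))
      (Complex.exp (-(Complex.I * ω * x))) x := by
    intro x _
    have h2 : HasDerivAt (fun x : ℝ => -(Complex.I * ω * x)) (-(Complex.I * ω * 1)) x :=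
      ((Complex.ofRealCLM.hasDerivAt (x := x)).const_mul (Complex.I * ω)).neg
    refine (h2.cexp.const_mul (-(1 / (Complex.I * ω)))).congr_deriv ?_
    rw [show ∀ u : ℂ, -(1 / (Complex.I * ω)) * (u * -(Complex.I * ω * 1)) =
      u * ((Complex.I * ω) / (Complex.I * ω)) by intro u; ring, div_self hωC, mul_one]
  have hcont := continuous_logDerivReal hd hw
  rw [h1, intervalIntegral.integral_mul_deriv_eq_deriv_mul hu hv
    (Continuous.intervalIntegrable (by fun_prop) _ _)
    (Continuous.intervalIntegrable (by fun_prop) _ _), logWeight_neg hw, sub_self]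
  simp only [Complex.ofReal_zero, zero_mul, sub_self, zero_sub]
  rw [← intervalIntegral.integral_const_mul, ← intervalIntegral.integral_neg]
  refine intervalIntegral.integral_congr fun x _ => ?_
  ring

/-- The transform of the function that is `1` on `[-α, α]` and decays at rate `b` outside. -/
theorem ft_exp_neg_max {b α ω : ℝ} (hb : 0 < b) (hα : 0 < α) (hω : ω ≠ 0) :
    ft (fun x => Real.exp (-(b * max (|x| - α) 0))) ω =
      ((2 * b * (b * Real.sin (α * ω) + ω * Real.cos (α * ω)) / (ω * (b ^ 2 +
          ω ^ 2)) : ℝ) : ℂ) := by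
  have hωC : (ω : ℂ) ≠ 0 := by exact_mod_cast hω
  have hIω : -(Complex.I * ω) ≠ 0 := neg_ne_zero.2 (mul_ne_zero Complex.I_ne_zero hωC)
  have hi := Integrable.mul_cexp (integrable_exp_neg_max (α := α) hb) ω
  rw [ft, ← intervalIntegral.integral_Iic_add_Ioi (b := -α) hi.integrableOn hi.integrableOn,
    ← intervalIntegral.integral_interval_add_Ioi (a := -α) (b := α) hi.integrableOn
      hi.integrableOn]
  have e1 : ∫ x in Set.Iic (-α), ((Real.exp (-(b * max (|x| - α) 0)) : ℝ) : ℂ) *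
      Complex.exp (-(Complex.I * ω * x)) =
          Complex.exp (Complex.I * ω * α) / (b - Complex.I * ω) := by
    have : ∫ x in Set.Iic (-α), ((Real.exp (-(b * max (|x| - α) 0)) : ℝ) : ℂ) *
        Complex.exp (-(Complex.I * ω * x)) =
        ∫ x in Set.Iic (-α), Complex.exp (b * α) * Complex.exp ((b - Complex.I * ω) * x) := by
      refine setIntegral_congr_fun measurableSet_Iic fun x hx => ?_
      have hx' : x ≤ -α := hx
      rw [abs_of_nonpos (by linarith), max_eq_left (by linarith)]
      push_cast
      rw [← Complex.exp_add, ← Complex.exp_add]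
      ring_nf
    rw [this, integral_const_mul, integral_exp_mul_complex_Iic (by simpa using hb), ← mul_div_assoc,
      ← Complex.exp_add]
    push_cast
    ring_nf
  have e2 : ∫ x in Set.Ioi α, ((Real.exp (-(b * max (|x| - α) 0)) : ℝ) : ℂ) *
      Complex.exp (-(Complex.I * ω * x)) =
      Complex.exp (-(Complex.I * ω * α)) / (b + Complex.I * ω) := by
    have : ∫ x in Set.Ioi α, ((Real.exp (-(b * max (|x| - α) 0)) : ℝ) : ℂ) *
        Complex.exp (-(Complex.I * ω * x)) =
        ∫ x in Set.Ioi α, Complex.exp (b * α) * Complex.exp ((-(b + Complex.I * ω)) * x) := by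
      refine setIntegral_congr_fun measurableSet_Ioi fun x hx => ?_
      have hx' : α < x := hx
      rw [abs_of_nonneg (by linarith), max_eq_left (by linarith)]
      push_cast
      rw [← Complex.exp_add, ← Complex.exp_add]
      ring_nf
    rw [this, integral_const_mul, integral_exp_mul_complex_Ioi (by simpa using hb), neg_div_neg_eq,
      ← mul_div_assoc, ← Complex.exp_add]
    ring_nf
  have e3 : ∫ x in (-α)..α, ((Real.exp (-(b * max (|x| - α) 0)) : ℝ) : ℂ) *
      Complex.exp (-(Complex.I * ω * x)) =
      (Complex.exp (-(Complex.I * ω * α)) - Complex.exp (Complex.I * ω * α)) / -(Complex.I * ω)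
          := by
    have : ∫ x in (-α)..α, ((Real.exp (-(b * max (|x| - α) 0)) : ℝ) : ℂ) *
        Complex.exp (-(Complex.I * ω * x)) =
        ∫ x in (-α)..α, Complex.exp (-(Complex.I * ω) * x) := by
      refine intervalIntegral.integral_congr fun x hx => ?_
      rw [Set.uIcc_of_le (by linarith)] at hx
      have hx' : |x| ≤ α := abs_le.2 hx
      rw [max_eq_right (by linarith)]
      simp
    rw [this, integral_exp_mul_complex hIω]
    push_cast
    ring_nf
  rw [e1, e2, e3]
  have hp : Complex.exp (Complex.I * ω * α) =
      Complex.cos ((α * ω : ℝ) : ℂ) + Complex.sin ((α * ω : ℝ) : ℂ) * Complex.I := by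
    rw [← Complex.exp_mul_I]
    push_cast
    ring_nf
  have hm : Complex.exp (-(Complex.I * ω * α)) =
      Complex.cos ((α * ω : ℝ) : ℂ) - Complex.sin ((α * ω : ℝ) : ℂ) * Complex.I := by
    rw [show -(Complex.I * ω * α) = ((-(α * ω) : ℝ) : ℂ) * Complex.I by push_cast; ring,
      Complex.exp_mul_I]
    push_cast
    rw [Complex.cos_neg, Complex.sin_neg]
    ring
  rw [hp, hm, ← Complex.ofReal_cos, ← Complex.ofReal_sin]
  have h1 : (b : ℂ) - Complex.I * ω ≠ 0 := fun h => by
    have := congrArg Complex.re h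
    simp at this; linarith
  have h2 : (b : ℂ) + Complex.I * ω ≠ 0 := fun h => by
    have := congrArg Complex.re h
    simp at this; linarith
  have h3 : (b : ℂ) ^ 2 + ω ^ 2 = (b - Complex.I * ω) * (b + Complex.I * ω) := by
    linear_combination (ω : ℂ) ^ 2 * Complex.I_sq
  have h4 : (b : ℂ) ^ 2 + ω ^ 2 ≠ 0 := h3 ▸ mul_ne_zero h1 h2
  simp only [Complex.ofReal_mul, Complex.ofReal_div, Complex.ofReal_add, Complex.ofReal_pow,
    Complex.ofReal_ofNat]
  generalize ((Real.sin (α * ω) : ℝ) : ℂ) = S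
  generalize ((Real.cos (α * ω) : ℝ) : ℂ) = C
  have hI := Complex.I_sq
  have q1 : (C + S * Complex.I) / (b - Complex.I * ω) =
      (C + S * Complex.I) * (b + Complex.I * ω) / (b ^ 2 + ω ^ 2) := by
    rw [h3]; field_simp
  have q2 : (C - S * Complex.I) / (b + Complex.I * ω) =
      (C - S * Complex.I) * (b - Complex.I * ω) / (b ^ 2 + ω ^ 2) := by
    rw [h3]; field_simp
  have q3 : (C - S * Complex.I - (C + S * Complex.I)) / -(Complex.I * ω) = 2 * S / ω := by
    have := Complex.I_ne_zero
    field_simp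
    ring
  rw [q1, q2, q3]
  field_simp
  linear_combination (2 * S * ω ^ 2) * hI

/-- The explicit Fourier transform defining the density is the multiplier `ω / (π tanh(dω))`
applied to the Fourier transform of the potential. -/
theorem densityFourier_eq {d : ℝ} {w : ℂ → ℂ} (hd : 0 < d) (hw : IsWeight d w) {α ω : ℝ}
    (hα : 0 < α) (hω : ω ≠ 0) :
    densityFourier d w α ω =
      ((ω / (Real.pi * Real.tanh (d * ω)) : ℝ) : ℂ) * ft (potential d w α) ω := by
  have hpi := Real.pi_pos
  have hb : 0 < Real.pi / (2 * d) := by positivity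
  have e : ft (potential d w α) ω = ft (fun x => logWeight w (min |x| α) - logWeight w α) ω +
      ((-(2 * d / Real.pi * logDerivReal w α) : ℝ) : ℂ) *
        ft (fun x => Real.exp (-(Real.pi / (2 * d) * max (|x| - α) 0))) ω := by
    rw [ft, ft, ft, ← integral_const_mul, ← integral_add
      (Integrable.mul_cexp (integrable_potential_bump hd hw α) ω)
      ((Integrable.mul_cexp (integrable_exp_neg_max hb) ω).const_mul _)]
    refine integral_congr_ae (Eventually.of_forall fun x => ?_)
    simp only [potential]
    push_cast
    ring
  have ht : Real.tanh (d * ω) ≠ 0 := fun h =>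
    mul_ne_zero hd.ne' hω (Real.tanh_injective (by rw [h, Real.tanh_zero]))
  have htC : ((Real.tanh (d * ω) : ℝ) : ℂ) ≠ 0 := by exact_mod_cast ht
  have hωC : (ω : ℂ) ≠ 0 := by exact_mod_cast hω
  have hpiC : (Real.pi : ℂ) ≠ 0 := by exact_mod_cast hpi.ne'
  have hI := Complex.I_ne_zero
  rw [e, ft_potential_bump hd hw hα hω, ft_exp_neg_max hb hα hω, mul_add, densityFourier,
    sub_eq_add_neg, ← Complex.ofReal_mul, ← Complex.ofReal_mul, ← Complex.ofReal_neg]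
  congr 1
  · push_cast at htC ⊢
    field_simp
  · congr 1
    have h1 : Real.pi ^ 2 + 4 * d ^ 2 * ω ^ 2 ≠ 0 := by positivity
    have h2 : (Real.pi / (2 * d)) ^ 2 + ω ^ 2 = (Real.pi ^ 2 +
        4 * d ^ 2 * ω ^ 2) / (4 * d ^ 2) := by
      field_simp
      ring
    rw [h2]
    field_simp

theorem integral_exp_neg_max {b α : ℝ} (hb : 0 < b) (hα : 0 < α) :
    ∫ x, Real.exp (-(b * max (|x| - α) 0)) = 2 * α + 2 / b := by
  have hi := integrable_exp_neg_max (α := α) hb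
  rw [← intervalIntegral.integral_Iic_add_Ioi (b := -α) hi.integrableOn hi.integrableOn,
    ← intervalIntegral.integral_interval_add_Ioi (a := -α) (b := α) hi.integrableOn
      hi.integrableOn]
  have e1 : ∫ x in Set.Iic (-α), Real.exp (-(b * max (|x| - α) 0)) = 1 / b := by
    have : ∫ x in Set.Iic (-α), Real.exp (-(b * max (|x| - α) 0)) =
        ∫ x in Set.Iic (-α), Real.exp (b * α) * Real.exp (b * x) := by
      refine setIntegral_congr_fun measurableSet_Iic fun x hx => ?_
      have hx' : x ≤ -α := hx
      rw [abs_of_nonpos (by linarith), max_eq_left (by linarith), ← Real.exp_add]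
      ring_nf
    rw [this, integral_const_mul, integral_exp_mul_Iic hb, ← mul_div_assoc, ← Real.exp_add]
    simp
  have e2 : ∫ x in Set.Ioi α, Real.exp (-(b * max (|x| - α) 0)) = 1 / b := by
    have : ∫ x in Set.Ioi α, Real.exp (-(b * max (|x| - α) 0)) =
        ∫ x in Set.Ioi α, Real.exp (b * α) * Real.exp (-b * x) := by
      refine setIntegral_congr_fun measurableSet_Ioi fun x hx => ?_
      have hx' : α < x := hx
      rw [abs_of_nonneg (by linarith), max_eq_left (by linarith), ← Real.exp_add]
      ring_nf
    rw [this, integral_const_mul, integral_exp_mul_Ioi (by linarith), neg_div_neg_eq,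
      ← mul_div_assoc, ← Real.exp_add]
    simp
  have e3 : ∫ x in (-α)..α, Real.exp (-(b * max (|x| - α) 0)) = 2 * α := by
    have : ∫ x in (-α)..α, Real.exp (-(b * max (|x| - α) 0)) = ∫ x in (-α)..α, (1 : ℝ) := by
      refine intervalIntegral.integral_congr fun x hx => ?_
      rw [Set.uIcc_of_le (by linarith)] at hx
      have hx' : |x| ≤ α := abs_le.2 hx
      rw [max_eq_right (by linarith)]
      simp
    rw [this, intervalIntegral.integral_const, smul_eq_mul]
    ring
  rw [e1, e2, e3]
  ring

/-- The equation for the end point says that the potential has integral `2πd(N + 1)`. -/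
theorem integral_potential {d : ℝ} {w : ℂ → ℂ} (hd : 0 < d) (hw : IsWeight d w) {N : ℕ} {α : ℝ}
    (hα : IsEndpoint d w N α) :
    ∫ x, potential d w α x = Real.pi * d * (2 * ((N : ℝ) + 1)) := by
  obtain ⟨hα0, heq⟩ := hα
  have hpi := Real.pi_pos
  have hb : 0 < Real.pi / (2 * d) := by positivity
  have hcont := continuous_logDerivReal hd hw
  have hc := continuous_logWeight hd hw
  have e1 : ∫ x, (logWeight w (min |x| α) - logWeight w α) =
      -∫ x in (-α)..α, x * logDerivReal w x := by
    have h1 : ∫ x, (logWeight w (min |x| α) - logWeight w α) =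
        ∫ x in (-α)..α, (logWeight w x - logWeight w α) * 1 := by
      rw [← setIntegral_eq_integral_of_forall_compl_eq_zero (s := Set.Ioc (-α) α),
        intervalIntegral.integral_of_le (by linarith)]
      · refine setIntegral_congr_fun measurableSet_Ioc fun x hx => ?_
        rw [min_eq_left (abs_le.2 ⟨hx.1.le, hx.2⟩), logWeight_abs hw, mul_one]
      · intro x hx
        exact potential_bump_eq_zero hx
    rw [h1, intervalIntegral.integral_mul_deriv_eq_deriv_mul
      (fun x _ => (hasDerivAt_logWeight hd hw x).sub_const _) (fun x _ => hasDerivAt_id x)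
      (hcont.intervalIntegrable _ _) (continuous_const.intervalIntegrable _ _),
      logWeight_neg hw, sub_self]
    simp only [zero_mul, sub_self, zero_sub, id]
    congr 1
    exact intervalIntegral.integral_congr fun x _ => mul_comm _ _
  have e2 : ∫ x, potential d w α x = (∫ x, (logWeight w (min |x| α) - logWeight w α)) +
      -(2 * d / Real.pi * logDerivReal w α) * (2 * α + 2 / (Real.pi / (2 * d))) := by
    rw [← integral_exp_neg_max hb hα0, ← integral_const_mul, ← integral_add
      (integrable_potential_bump hd hw α) ((integrable_exp_neg_max hb).const_mul _)]
    rfl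
  rw [e2, e1, ← heq]
  field_simp
  ring

/-! ### The density and its potential -/

theorem norm_ft_le (k : ℝ → ℝ) (ω : ℝ) : ‖ft k ω‖ ≤ ∫ t, ‖k t‖ := by
  refine (norm_integral_le_integral_norm _).trans_eq ?_
  simp only [norm_mul, norm_cexp_neg_I_mul, mul_one, Complex.norm_real]

theorem continuous_ft {k : ℝ → ℝ} (hk : Integrable k) : Continuous (ft k) := by
  refine continuous_of_dominated (bound := fun x => ‖k x‖)
    (fun ω => (Integrable.mul_cexp hk ω).aestronglyMeasurable) ?_ hk.norm ?_
  · intro ω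
    refine Eventually.of_forall fun x => ?_
    rw [norm_mul, norm_cexp_neg_I_mul, mul_one, Complex.norm_real]
  · exact Eventually.of_forall fun x => by fun_prop

theorem tanh_ne_zero {u : ℝ} (hu : u ≠ 0) : Real.tanh u ≠ 0 := fun h =>
  hu (Real.tanh_injective (by rw [h, Real.tanh_zero]))

theorem densityFourier_mul_ft_green {d : ℝ} {w : ℂ → ℂ} (hd : 0 < d) (hw : IsWeight d w)
    {α ω : ℝ} (hα : 0 < α) (hω : ω ≠ 0) :
    densityFourier d w α ω * ft (green d) ω = ft (potential d w α) ω := by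
  have hpi := Real.pi_pos
  have ht := tanh_ne_zero (mul_ne_zero hd.ne' hω)
  rw [densityFourier_eq hd hw hα hω, ft_green hd hω, mul_right_comm, ← Complex.ofReal_mul]
  rw [show ω / (Real.pi * Real.tanh (d * ω)) * (Real.pi / ω * Real.tanh (d * ω)) = 1 by
    generalize Real.tanh (d * ω) = t at ht
    field_simp]
  rw [Complex.ofReal_one, one_mul]

theorem integrable_ft_potential {d : ℝ} {w : ℂ → ℂ} (hd : 0 < d) (hw : IsWeight d w)
    {α : ℝ} (hα : 0 < α) (hF : Integrable (densityFourier d w α)) :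
    Integrable (ft (potential d w α)) := by
  have h : Integrable fun ω => densityFourier d w α ω * ft (green d) ω :=
    hF.mul_bdd (continuous_ft (integrable_green hd)).aestronglyMeasurable
      (Eventually.of_forall fun ω => norm_ft_le (green d) ω)
  refine h.congr ?_
  filter_upwards [ae_ne_zero] with ω hω
  exact densityFourier_mul_ft_green hd hw hα hω

theorem density_eq (d : ℝ) (w : ℂ → ℂ) (α x : ℝ) :
    density d w α x = 1 / (2 * Real.pi) *
      (∫ ω : ℝ, densityFourier d w α ω * Complex.exp (Complex.I * ω * x)).re := by
  rw [density, show (1 / (2 * Real.pi) : ℂ) = ((1 / (2 * Real.pi) : ℝ) : ℂ) by push_cast; rfl,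
    Complex.re_ofReal_mul]

theorem continuous_density {d : ℝ} {w : ℂ → ℂ} {α : ℝ} (hF : Integrable (densityFourier d w α)) :
    Continuous (density d w α) := by
  rw [show density d w α = fun x => _ from funext fun x => density_eq d w α x]
  exact continuous_const.mul (Complex.continuous_re.comp (continuous_integral_mul_cexp hF))

theorem norm_integral_mul_cexp_le (H : ℝ → ℂ) (x : ℝ) :
    ‖∫ ω : ℝ, H ω * Complex.exp (Complex.I * ω * x)‖ ≤ ∫ ω, ‖H ω‖ := by
  refine (norm_integral_le_integral_norm _).trans_eq ?_
  simp only [norm_mul, norm_cexp_I_mul, mul_one]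

theorem abs_density_le (d : ℝ) (w : ℂ → ℂ) (α x : ℝ) :
    |density d w α x| ≤ 1 / (2 * Real.pi) * ∫ ω, ‖densityFourier d w α ω‖ := by
  have hpi := Real.pi_pos
  rw [density_eq, abs_mul, abs_of_pos (by positivity)]
  exact mul_le_mul_of_nonneg_left ((Complex.abs_re_le_norm _).trans
    (norm_integral_mul_cexp_le _ x)) (by positivity)

theorem integrable_kernel_mul_density {d : ℝ} {w : ℂ → ℂ} {α : ℝ}
    (hF : Integrable (densityFourier d w α)) {k : ℝ → ℝ} (hk : Integrable k) (x : ℝ) :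
    Integrable fun z => k (x - z) * density d w α z :=
  (hk.comp_sub_left x).mul_bdd (continuous_density hF).aestronglyMeasurable
    (Eventually.of_forall fun z => abs_density_le d w α z)

/-- The Green potential of the density is `potential`. -/
theorem integral_green_mul_density {d : ℝ} {w : ℂ → ℂ} (hd : 0 < d) (hw : IsWeight d w)
    {α : ℝ} (hα : 0 < α) (hF : Integrable (densityFourier d w α)) (x : ℝ) :
    ∫ z, green d (x - z) * density d w α z = potential d w α x := by
  have hpi := Real.pi_pos
  have h1 := integral_kernel_mul_inverse (integrable_green hd) hF x
  have h2 : ∫ ω : ℝ, densityFourier d w α ω * ft (green d) ω * Complex.exp (Complex.I * ω * x) =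
      2 * Real.pi * potential d w α x := by
    rw [← fourier_inversion (continuous_potential hd hw α) (integrable_potential hd hw α)
      (integrable_ft_potential hd hw hα hF)]
    refine integral_congr_ae ?_
    filter_upwards [ae_ne_zero] with ω hω
    rw [densityFourier_mul_ft_green hd hw hα hω]
  rw [h2] at h1
  have hi : Integrable fun z : ℝ => (green d (x - z) : ℂ) *
      ∫ ω : ℝ, densityFourier d w α ω * Complex.exp (Complex.I * ω * z) :=
    ((integrable_green hd).comp_sub_left x).ofReal.mul_bdd
      (continuous_integral_mul_cexp hF).aestronglyMeasurable
      (Eventually.of_forall fun z => norm_integral_mul_cexp_le _ z)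
  have h3 := congrArg Complex.re h1
  have h4 := integral_re hi
  simp only [RCLike.re_eq_complex_re] at h4
  rw [← h4, show (2 * (Real.pi : ℂ) * potential d w α x) =
    ((2 * Real.pi * potential d w α x : ℝ) : ℂ) by push_cast; rfl, Complex.ofReal_re] at h3
  have h5 : ∫ z, green d (x - z) * density d w α z = 1 / (2 * Real.pi) *
      ∫ z : ℝ, ((green d (x - z) : ℂ) *
        ∫ ω : ℝ, densityFourier d w α ω * Complex.exp (Complex.I * ω * z)).re := by
    rw [← integral_const_mul]
    refine integral_congr_ae (Eventually.of_forall fun z => ?_)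
    simp only [Complex.re_ofReal_mul]
    rw [density_eq]
    ring
  rw [h5, h3]
  field_simp

/-- Convolution with the exponential probability density `(c/2) exp(-c|t|)`. -/
def expConv (c : ℝ) (h : ℝ → ℝ) (x : ℝ) : ℝ := ∫ z, expKernel c (x - z) * h z

/-- The partial fractions of `ω coth(dω)` express the density by the deviations of its potential
from its exponential averages. -/
theorem hasSum_potential_sub_expConv {d : ℝ} {w : ℂ → ℂ} (hd : 0 < d) (hw : IsWeight d w)
    {α : ℝ} (hα : 0 < α) (hF : Integrable (densityFourier d w α)) (x : ℝ) :
    HasSum (fun n : ℕ => potential d w α x -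
        expConv (((n : ℝ) + 1) * (Real.pi / d)) (potential d w α) x)
      ((Real.pi * d * density d w α x - potential d w α x) / 2) := by
  have hpi := Real.pi_pos
  set W := potential d w α with hW
  set c : ℕ → ℝ := fun n => ((n : ℝ) + 1) * (Real.pi / d) with hc
  have hc0 : ∀ n, 0 < c n := fun n => by simp only [hc]; positivity
  have hWi : Integrable (ft W) := integrable_ft_potential hd hw hα hF
  set G : ℝ → ℂ := fun ω => (Real.pi * d * densityFourier d w α ω - ft W ω) / 2 with hG
  have hGi : Integrable G := ((hF.const_mul (Real.pi * d : ℂ)).sub hWi).div_const 2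
  have hmsum : ∀ ω : ℝ, ω ≠ 0 → HasSum (fun n => ω ^ 2 / (ω ^ 2 + c n ^ 2))
      ((d * ω / Real.tanh (d * ω) - 1) / 2) := by
    intro ω hω
    have h := (hasSum_coth_partial_fractions (mul_ne_zero hd.ne' hω)).div_const 2
    refine h.congr_fun fun n => ?_
    have : 0 < ω ^ 2 := by positivity
    simp only [hc]
    field_simp
  have hGm : ∀ ω : ℝ, ω ≠ 0 → G ω = ft W ω * (((d * ω / Real.tanh (d * ω) - 1) / 2 : ℝ) : ℂ) := by
    intro ω hω
    have ht : ((Real.tanh (d * ω) : ℝ) : ℂ) ≠ 0 := by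
      exact_mod_cast tanh_ne_zero (mul_ne_zero hd.ne' hω)
    have hpiC : (Real.pi : ℂ) ≠ 0 := by exact_mod_cast hpi.ne'
    simp only [hG]
    rw [densityFourier_eq hd hw hα hω, ← hW]
    push_cast at ht ⊢
    field_simp
  have hm0 : ∀ (n : ℕ) (ω : ℝ), 0 ≤ ω ^ 2 / (ω ^ 2 + c n ^ 2) := fun n ω => by positivity
  have key : HasSum (fun n => ∫ ω : ℝ, ft W ω * ((ω ^ 2 / (ω ^ 2 + c n ^ 2) : ℝ) : ℂ) *
      Complex.exp (Complex.I * ω * x)) (∫ ω : ℝ, G ω * Complex.exp (Complex.I * ω * x)) := by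
    refine hasSum_integral_of_dominated_convergence
      (fun n ω => ‖ft W ω‖ * (ω ^ 2 / (ω ^ 2 + c n ^ 2))) (fun n => ?_) (fun n => ?_) ?_ ?_ ?_
    · have hne : ∀ ω : ℝ, ω ^ 2 + c n ^ 2 ≠ 0 := fun ω => by
        have := hc0 n; positivity
      have h1 : Continuous fun ω : ℝ => ω ^ 2 / (ω ^ 2 + c n ^ 2) :=
        Continuous.div (by fun_prop) (by fun_prop) hne
      have h2 : Continuous (ft W) := continuous_ft (integrable_potential hd hw α)
      exact (by fun_prop : Continuous fun ω : ℝ => ft W ω * ((ω ^ 2 / (ω ^ 2 + c n ^ 2) : ℝ) : ℂ) *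
        Complex.exp (Complex.I * ω * x)).aestronglyMeasurable
    · refine Eventually.of_forall fun ω => ?_
      rw [norm_mul, norm_mul, norm_cexp_I_mul, mul_one, Complex.norm_real,
        Real.norm_of_nonneg (hm0 n ω)]
    · filter_upwards [ae_ne_zero] with ω hω
      exact (hmsum ω hω).summable.mul_left _
    · refine hGi.norm.congr ?_
      filter_upwards [ae_ne_zero] with ω hω
      rw [tsum_mul_left, (hmsum ω hω).tsum_eq, hGm ω hω, norm_mul, Complex.norm_real,
        Real.norm_of_nonneg ((hmsum ω hω).nonneg fun n => hm0 n ω)]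
    · filter_upwards [ae_ne_zero] with ω hω
      rw [hGm ω hω]
      exact ((Complex.hasSum_ofReal.2 (hmsum ω hω)).mul_left _).mul_right _
  have hterm : ∀ n, ∫ ω : ℝ, ft W ω * ((ω ^ 2 / (ω ^ 2 + c n ^ 2) : ℝ) : ℂ) *
      Complex.exp (Complex.I * ω * x) = ((2 * Real.pi * (W x - expConv (c n) W x) : ℝ) : ℂ) := by
    intro n
    have hk := integrable_expKernel (hc0 n)
    have h1 := integral_kernel_mul_inverse hk hWi x
    have hinv := fourier_inversion (continuous_potential hd hw α) (integrable_potential hd hw α) hWi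
    have h2 : ∫ z : ℝ, (expKernel (c n) (x - z) : ℂ) *
        ∫ ω : ℝ, ft W ω * Complex.exp (Complex.I * ω * z) =
        ((2 * Real.pi * expConv (c n) W x : ℝ) : ℂ) := by
      rw [expConv, ← integral_const_mul, ← integral_complex_ofReal]
      refine integral_congr_ae (Eventually.of_forall fun z => ?_)
      simp only
      rw [hinv z]
      push_cast
      ring
    have hi2 : Integrable fun ω : ℝ => ft W ω * ft (expKernel (c n)) ω *
        Complex.exp (Complex.I * ω * x) := by
      refine integrable_ft_mul_cexp (hWi.mul_bdd (continuous_ft hk).aestronglyMeasurable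
        (Eventually.of_forall fun ω => norm_ft_le _ ω)) x
    rw [mul_sub, Complex.ofReal_sub, ← h2, h1,
      show ((2 * Real.pi * W x : ℝ) : ℂ) = 2 * Real.pi * W x by push_cast; rfl, ← hinv x,
      ← integral_sub (integrable_ft_mul_cexp hWi x) hi2]
    refine integral_congr_ae (Eventually.of_forall fun ω => ?_)
    simp only
    rw [ft_expKernel (hc0 n)]
    have h3 : ω ^ 2 / (ω ^ 2 + c n ^ 2) = 1 - c n ^ 2 / (ω ^ 2 + c n ^ 2) := by
      have := hc0 n
      field_simp
      ring
    rw [h3]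
    push_cast
    ring
  have hre : (∫ ω : ℝ, G ω * Complex.exp (Complex.I * ω * x)).re =
      2 * Real.pi * ((Real.pi * d * density d w α x - W x) / 2) := by
    have hinv := fourier_inversion (continuous_potential hd hw α) (integrable_potential hd hw α)
      hWi x
    have h1 : ∫ ω : ℝ, G ω * Complex.exp (Complex.I * ω * x) =
        ((Real.pi * d / 2 : ℝ) : ℂ) *
          (∫ ω : ℝ, densityFourier d w α ω * Complex.exp (Complex.I * ω * x)) -
        ((Real.pi * W x : ℝ) : ℂ) := by
      have h2 : ((Real.pi * W x : ℝ) : ℂ) = (1 / 2 : ℂ) *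
          ∫ ω : ℝ, ft W ω * Complex.exp (Complex.I * ω * x) := by
        rw [hinv]; push_cast; ring
      rw [h2, ← integral_const_mul, ← integral_const_mul,
        ← integral_sub ((integrable_ft_mul_cexp hF x).const_mul _)
          ((integrable_ft_mul_cexp hWi x).const_mul _)]
      refine integral_congr_ae (Eventually.of_forall fun ω => ?_)
      simp only [hG]
      push_cast
      ring
    rw [h1, Complex.sub_re, Complex.re_ofReal_mul, Complex.ofReal_re, density_eq]
    generalize (∫ ω : ℝ, densityFourier d w α ω * Complex.exp (Complex.I * ω * x)).re = q
    field_simp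
  have key2 := Complex.hasSum_re key
  simp only [hterm, Complex.ofReal_re] at key2
  rw [hre] at key2
  exact (hasSum_mul_left_iff (by positivity)).1 key2

theorem density_neg {d : ℝ} {w : ℂ → ℂ} (hd : 0 < d) (hw : IsWeight d w)
    {α : ℝ} (hα : 0 < α) (hF : Integrable (densityFourier d w α)) (x : ℝ) :
    density d w α (-x) = density d w α x := by
  have hpi := Real.pi_pos
  have h1 := hasSum_potential_sub_expConv hd hw hα hF (-x)
  have h2 := hasSum_potential_sub_expConv hd hw hα hF x
  have h3 : ∀ c, expConv c (potential d w α) (-x) = expConv c (potential d w α) x := by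
    intro c
    rw [expConv, expConv, ← integral_neg_eq_self]
    refine integral_congr_ae (Eventually.of_forall fun z => ?_)
    simp only
    rw [potential_neg, expKernel, expKernel, show -x - -z = -(x - z) by ring, abs_neg]
  simp only [h3, potential_neg] at h1
  have := h1.unique h2
  have hpd : 0 < Real.pi * d := by positivity
  have h4 : Real.pi * d * density d w α (-x) = Real.pi * d * density d w α x := by linarith
  exact mul_left_cancel₀ hpd.ne' h4

/-! ### Positivity of the density and its decay outside the interval -/

theorem integrable_expKernel_mul_exp {c β : ℝ} (hβ : |β| < c) (x y : ℝ) :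
    Integrable fun z => expKernel c (x - z) * Real.exp (β * (z - y)) := by
  have h := (integrable_exp_neg_abs_mul_cexp (c := c) (z := ((-β : ℝ) : ℂ)) (by simpa using hβ)).re
  have h2 := ((h.comp_sub_left x).const_mul (c / 2 * Real.exp (β * (x - y))))
  refine h2.congr (Eventually.of_forall fun z => ?_)
  simp only [RCLike.re_eq_complex_re]
  rw [← Complex.ofReal_mul, ← Complex.ofReal_exp, Complex.re_ofReal_mul, Complex.ofReal_re,
      expKernel,
    show β * (z - y) = β * (x - y) + -β * (x - z) by ring, Real.exp_add]
  ring

theorem expConv_exp {c β : ℝ} (hβ : |β| < c) (x y : ℝ) :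
    expConv c (fun z => Real.exp (β * (z - y))) x =
      c ^ 2 / (c ^ 2 - β ^ 2) * Real.exp (β * (x - y)) := by
  have h := integral_exp_neg_abs_mul_cexp (c := c) (z := ((-β : ℝ) : ℂ)) (by simpa using hβ)
  have h2 : ∫ t : ℝ, Real.exp (-(c * |t|)) * Real.exp (-β * t) = 2 * c / (c ^ 2 - β ^ 2) := by
    have : ∫ t : ℝ, ((Real.exp (-(c * |t|)) : ℝ) : ℂ) * Complex.exp (((-β : ℝ) : ℂ) * t) =
        ((∫ t : ℝ, Real.exp (-(c * |t|)) * Real.exp (-β * t) : ℝ) : ℂ) := by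
      rw [← integral_complex_ofReal]
      push_cast
      rfl
    rw [this] at h
    have h3 : (2 * (c : ℂ) / (c ^ 2 - ((-β : ℝ) : ℂ) ^ 2)) =
        ((2 * c / (c ^ 2 - β ^ 2) : ℝ) : ℂ) := by
      push_cast
      ring
    rw [h3] at h
    exact Complex.ofReal_injective h
  rw [expConv, ← integral_sub_left_eq_self _ _ x]
  have h4 : ∀ t : ℝ, expKernel c (x - (x - t)) * Real.exp (β * (x - t - y)) =
      c / 2 * Real.exp (β * (x - y)) * (Real.exp (-(c * |t|)) * Real.exp (-β * t)) := by
    intro t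
    rw [expKernel, sub_sub_cancel, show β * (x - t - y) = β * (x - y) + -β * t by ring,
        Real.exp_add]
    ring
  simp only [h4]
  rw [integral_const_mul, h2]
  ring

theorem expKernel_nonneg {c : ℝ} (hc : 0 < c) (t : ℝ) : 0 ≤ expKernel c t := by
  unfold expKernel; positivity

theorem integrable_expKernel_mul_potential {d : ℝ} {w : ℂ → ℂ} (hd : 0 < d) (hw : IsWeight d w)
    (α : ℝ) {c : ℝ} (hc : 0 < c) (x : ℝ) :
    Integrable fun z => expKernel c (x - z) * potential d w α z := by
  have hb : ∀ t, ‖expKernel c t‖ ≤ c / 2 := fun t => by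
    rw [Real.norm_of_nonneg (expKernel_nonneg hc t), expKernel]
    refine mul_le_of_le_one_right (by positivity) (Real.exp_le_one_iff.2 ?_)
    have : 0 ≤ c * |t| := by positivity
    linarith
  refine (integrable_potential hd hw α).bdd_mul (c := c / 2) ?_
    (Eventually.of_forall fun z => hb _)
  unfold expKernel
  exact (by fun_prop : Continuous fun z : ℝ =>
      c / 2 * Real.exp (-(c * |x - z|))).aestronglyMeasurable

/-- A telescoping series, as `4(n + 1)² - 1 = (2n + 1)(2n + 3)`. -/
theorem hasSum_inv_four_mul_sq_sub_one :
    HasSum (fun n : ℕ => 1 / (4 * ((n : ℝ) + 1) ^ 2 - 1)) (1 / 2) := by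
  have hpos : ∀ n : ℕ, 0 < 4 * ((n : ℝ) + 1) ^ 2 - 1 := fun n => by
    have : (0 : ℝ) ≤ n := Nat.cast_nonneg n
    nlinarith
  rw [hasSum_iff_tendsto_nat_of_nonneg (fun n => (one_div_pos.2 (hpos n)).le)]
  have hs : ∀ n : ℕ, ∑ i ∈ Finset.range n, 1 / (4 * ((i : ℝ) + 1) ^ 2 - 1) =
      1 / 2 - 1 / 2 * (1 / (2 * (n : ℝ) + 1)) := by
    intro n
    induction n with
    | zero => simp
    | succ n ih =>
      rw [Finset.sum_range_succ, ih]
      have h0 := (hpos n).ne'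
      have h1 : 2 * (n : ℝ) + 1 ≠ 0 := by positivity
      have h2 : 2 * (n : ℝ) + 1 + 2 ≠ 0 := by positivity
      have h3 : 4 * ((n : ℝ) + 1) ^ 2 - 1 = (2 * (n : ℝ) + 1) * (2 * (n : ℝ) + 1 + 2) := by ring
      push_cast
      rw [h3, show 2 * ((n : ℝ) + 1) + 1 = 2 * (n : ℝ) + 1 + 2 by ring]
      field_simp
      ring
  simp only [hs]
  have : Tendsto (fun n : ℕ => 1 / (2 * (n : ℝ) + 1)) atTop (𝓝 0) := by
    refine tendsto_const_nhds.div_atTop ?_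
    exact tendsto_atTop_add_const_right _ _
      (tendsto_natCast_atTop_atTop.const_mul_atTop (by norm_num))
  have h5 := (this.const_mul (1 / 2)).const_sub (1 / 2)
  rwa [mul_zero, sub_zero] at h5

theorem expRate_bound {d : ℝ} (hd : 0 < d) (n : ℕ) :
    Real.pi / (2 * d) < ((n : ℝ) + 1) * (Real.pi / d) := by
  have hpi := Real.pi_pos
  have h1 : Real.pi / d = 2 * (Real.pi / (2 * d)) := by field_simp
  have h2 : 0 < Real.pi / (2 * d) := by positivity
  have h3 : (0 : ℝ) ≤ n := Nat.cast_nonneg n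
  rw [h1]
  nlinarith

/-- Combinations of `exp(±πx/(2d))` are multiplied by `4n²/(4n² - 1)` under the averaging with
rate `nπ/d`. -/
theorem expConv_cosh_type {d : ℝ} (hd : 0 < d) (n : ℕ) (A B x y : ℝ) :
    (Integrable fun z => expKernel (((n : ℝ) + 1) * (Real.pi / d)) (x - z) *
      (A * Real.exp (-(Real.pi / (2 * d)) * (z - y)) +
          B * Real.exp (Real.pi / (2 * d) * (z - y)))) ∧
    expConv (((n : ℝ) + 1) * (Real.pi / d)) (fun z =>
        A * Real.exp (-(Real.pi / (2 * d)) * (z - y)) +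
        B * Real.exp (Real.pi / (2 * d) * (z - y))) x =
      (1 + 1 / (4 * ((n : ℝ) + 1) ^ 2 - 1)) * (A * Real.exp (-(Real.pi / (2 * d)) * (x - y)) +
        B * Real.exp (Real.pi / (2 * d) * (x - y))) := by
  have hpi := Real.pi_pos
  have hb : 0 < Real.pi / (2 * d) := by positivity
  have hlt := expRate_bound hd n
  set c := ((n : ℝ) + 1) * (Real.pi / d) with hc
  have h1 : |-(Real.pi / (2 * d))| < c := by rwa [abs_neg, abs_of_pos hb]
  have h2 : |Real.pi / (2 * d)| < c := by rwa [abs_of_pos hb]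
  have i1 := (integrable_expKernel_mul_exp h1 x y).const_mul A
  have i2 := (integrable_expKernel_mul_exp h2 x y).const_mul B
  have hfun : (fun z => expKernel c (x - z) *
      (A * Real.exp (-(Real.pi / (2 * d)) * (z - y)) +
          B * Real.exp (Real.pi / (2 * d) * (z - y)))) =
      fun z => A * (expKernel c (x - z) * Real.exp (-(Real.pi / (2 * d)) * (z - y))) +
        B * (expKernel c (x - z) * Real.exp (Real.pi / (2 * d) * (z - y))) := by
    funext z; ring
  have e1 := expConv_exp h1 x y
  have e2 := expConv_exp h2 x y
  rw [expConv] at e1 e2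
  rw [hfun]
  refine ⟨i1.add i2, ?_⟩
  rw [expConv, hfun, integral_add i1 i2, integral_const_mul, integral_const_mul, e1, e2, neg_sq]
  have hn : 0 < 4 * ((n : ℝ) + 1) ^ 2 - 1 := by
    have : (0 : ℝ) ≤ n := Nat.cast_nonneg n
    nlinarith
  have h3 : c ^ 2 / (c ^ 2 - (Real.pi / (2 * d)) ^ 2) = 1 + 1 / (4 * ((n : ℝ) + 1) ^ 2 - 1) := by
    have h4 : c ^ 2 - (Real.pi / (2 * d)) ^ 2 =
        (Real.pi / (2 * d)) ^ 2 * (4 * ((n : ℝ) + 1) ^ 2 - 1) := by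
      rw [hc]; field_simp; ring
    have h5 : c ^ 2 = (Real.pi / (2 * d)) ^ 2 * (4 * ((n : ℝ) + 1) ^ 2) := by
      rw [hc]; field_simp; ring
    rw [h4, h5, mul_div_mul_left _ _ (by positivity)]
    field_simp
    ring
  rw [h3]
  ring

/-- If a combination of `exp(±πx/(2d))` majorises the potential and touches it at `x`, the density
is the sum of the exponential averages of the difference at `x`. -/
theorem hasSum_expConv_majorant_sub {d : ℝ} {w : ℂ → ℂ} (hd : 0 < d) (hw : IsWeight d w)
    {α : ℝ} (hα : 0 < α) (hF : Integrable (densityFourier d w α)) {A B x y : ℝ}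
    (hx : potential d w α x = A * Real.exp (-(Real.pi / (2 * d)) * (x - y)) +
      B * Real.exp (Real.pi / (2 * d) * (x - y))) :
    HasSum (fun n : ℕ => expConv (((n : ℝ) + 1) * (Real.pi / d))
      (fun z => A * Real.exp (-(Real.pi / (2 * d)) * (z - y)) +
        B * Real.exp (Real.pi / (2 * d) * (z - y)) - potential d w α z) x)
      (Real.pi * d * density d w α x / 2) := by
  have hpi := Real.pi_pos
  have h1 := hasSum_potential_sub_expConv hd hw hα hF x
  have h2 := hasSum_inv_four_mul_sq_sub_one.mul_right (potential d w α x)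
  have h3 := h1.add h2
  rw [show (Real.pi * d * density d w α x - potential d w α x) / 2 + 1 / 2 * potential d w α x =
    Real.pi * d * density d w α x / 2 by ring] at h3
  refine h3.congr_fun fun n => ?_
  obtain ⟨hi, he⟩ := expConv_cosh_type hd n A B x y
  rw [← hx] at he
  rw [expConv] at he ⊢
  have hsub : ∀ k M W : ℝ, k * (M - W) = k * M - k * W := fun k M W => mul_sub k M W
  rw [integral_congr_ae (Eventually.of_forall fun z => hsub _ _ _),
    integral_sub hi (integrable_expKernel_mul_potential hd hw α (by positivity) x), he, expConv]
  ring

/-- Positivity at the points of contact with a majorant. -/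
theorem density_nonneg_of_majorant {d : ℝ} {w : ℂ → ℂ} (hd : 0 < d) (hw : IsWeight d w)
    {α : ℝ} (hα : 0 < α) (hF : Integrable (densityFourier d w α)) {A B x y : ℝ}
    (hx : potential d w α x = A * Real.exp (-(Real.pi / (2 * d)) * (x - y)) +
      B * Real.exp (Real.pi / (2 * d) * (x - y)))
    (hle : ∀ z, potential d w α z ≤ A * Real.exp (-(Real.pi / (2 * d)) * (z - y)) +
      B * Real.exp (Real.pi / (2 * d) * (z - y))) :
    0 ≤ density d w α x := by
  have hpi := Real.pi_pos
  have h := (hasSum_expConv_majorant_sub hd hw hα hF hx).nonneg fun n =>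
    integral_nonneg fun z => mul_nonneg (expKernel_nonneg (by positivity) _) (sub_nonneg.2 (hle z))
  by_contra! hneg
  have : Real.pi * d * density d w α x < 0 := mul_neg_of_pos_of_neg (by positivity) hneg
  linarith

theorem logWeight_endpoint_le {d : ℝ} {w : ℂ → ℂ} (hd : 0 < d) (hw : IsWeight d w) {α x : ℝ}
    (hx : |x| ≤ α) : logWeight w α ≤ logWeight w x := by
  have h1 := logWeight_le_tangent hd hw |x| α
  have h2 := logDerivReal_nonpos hd hw (abs_nonneg x)
  rw [logWeight_abs hw] at h1
  nlinarith

theorem potential_nonneg {d : ℝ} {w : ℂ → ℂ} (hd : 0 < d) (hw : IsWeight d w) {α : ℝ} (hα : 0 < α)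
    (x : ℝ) : 0 ≤ potential d w α x := by
  have h0 := neg_mul_logDerivReal_nonneg hd hw hα
  refine add_nonneg (sub_nonneg.2 (logWeight_endpoint_le hd hw ?_)) (by positivity)
  rw [abs_of_nonneg (le_min (abs_nonneg x) hα.le)]
  exact min_le_right _ _

/-- At each point of `[-α, α]` the potential is touched from above by a combination of
`exp(±πx/(2d))` with the same value and slope. -/
theorem potential_le_majorant {d : ℝ} {w : ℂ → ℂ} (hd : 0 < d) (hw : IsWeight d w) {α x : ℝ}
    (hα : 0 < α) (hx : |x| ≤ α) (z : ℝ) :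
    potential d w α z ≤
      (potential d w α x - 2 * d / Real.pi * logDerivReal w x) / 2 *
          Real.exp (-(Real.pi / (2 * d)) * (z - x)) +
        (potential d w α x + 2 * d / Real.pi * logDerivReal w x) / 2 *
          Real.exp (Real.pi / (2 * d) * (z - x)) := by
  have hpi := Real.pi_pos
  set b := Real.pi / (2 * d) with hb
  have hb0 : 0 < b := by positivity
  set W := potential d w α with hW
  set s := logDerivReal w x with hs
  set l := logDerivReal w α with hl
  have hinv : 2 * d / Real.pi = 1 / b := by rw [hb]; field_simp
  have hxab := abs_le.1 hx
  have hs1 : l ≤ s := logDerivReal_antitone hd hw hxab.2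
  have hs2 : s ≤ -l := by
    rw [hl, ← logDerivReal_neg hd hw]
    exact logDerivReal_antitone hd hw hxab.1
  have hWx : W x = logWeight w x - logWeight w α - 1 / b * l := by
    rw [hW, potential_of_abs_le hw hx, rateK, hinv, logWeight, logWeight]
    ring
  have hα' : |α| ≤ α := (abs_of_pos hα).le
  have hle := logWeight_endpoint_le hd hw hx
  rw [hinv]
  have hib : 0 < 1 / b := by positivity
  have hA : 0 ≤ (W x - 1 / b * s) / 2 := by
    have : 1 / b * s ≤ 1 / b * -l := mul_le_mul_of_nonneg_left hs2 hib.le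
    linarith
  have hB : 0 ≤ (W x + 1 / b * s) / 2 := by
    have : 1 / b * l ≤ 1 / b * s := mul_le_mul_of_nonneg_left hs1 hib.le
    linarith
  set A := (W x - 1 / b * s) / 2 with hAd
  set B := (W x + 1 / b * s) / 2 with hBd
  have hAB : A + B = W x := by rw [hAd, hBd]; ring
  have hBA : b * (B - A) = s := by rw [hAd, hBd]; field_simp; ring
  have hin : ∀ y, |y| ≤ α → W y ≤ A * Real.exp (-b * (y - x)) + B * Real.exp (b * (y - x)) := by
    intro y hy
    have h1 : W y ≤ W x + s * (y - x) := by
      rw [hWx, hW, potential_of_abs_le hw hy, rateK, hinv]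
      have := logWeight_le_tangent hd hw x y
      simp only [logWeight] at this ⊢
      linarith
    have h2 : A * (-b * (y - x) + 1) ≤ A * Real.exp (-b * (y - x)) :=
      mul_le_mul_of_nonneg_left (Real.add_one_le_exp _) hA
    have h3 : B * (b * (y - x) + 1) ≤ B * Real.exp (b * (y - x)) :=
      mul_le_mul_of_nonneg_left (Real.add_one_le_exp _) hB
    have h4 : A * (-b * (y - x) + 1) + B * (b * (y - x) + 1) = W x + s * (y - x) := by
      rw [← hAB, ← hBA]; ring
    linarith
  -- beyond the end points the potential decays at the fastest rate that the majorant allows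
  have hout : ∀ y t, |y| ≤ α → W z = W y * Real.exp (-b * t) → |z - y| ≤ t →
      W z ≤ A * Real.exp (-b * (z - x)) + B * Real.exp (b * (z - x)) := by
    intro y t hy hWz ht
    have ht' := abs_le.1 ht
    rw [hWz]
    refine (mul_le_mul_of_nonneg_right (hin y hy) (Real.exp_pos _).le).trans ?_
    rw [add_mul, mul_assoc, mul_assoc, ← Real.exp_add, ← Real.exp_add]
    refine add_le_add (mul_le_mul_of_nonneg_left (Real.exp_le_exp.2 ?_) hA)
      (mul_le_mul_of_nonneg_left (Real.exp_le_exp.2 ?_) hB)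
    · nlinarith
    · nlinarith
  by_cases hz : |z| ≤ α
  · exact hin z hz
  · push Not at hz
    have hWα : W α = -(2 * d / Real.pi * l) := by
      rw [hW, potential_of_abs_le hw hα', rateK, logWeight]
      ring
    have hWz : W z = W α * Real.exp (-b * (|z| - α)) := by
      rw [hWα, hW, potential_of_le_abs hz.le, neg_mul b]
    rcases le_or_gt 0 z with h0 | h0
    · refine hout α (|z| - α) hα' hWz ?_
      rw [abs_of_nonneg h0] at hz ⊢
      rw [abs_of_pos (by linarith)]
    · refine hout (-α) (|z| - α) (by rwa [abs_neg]) ?_ ?_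
      · rw [hWz, hW, potential_neg]
      · rw [abs_of_neg h0] at hz ⊢
        rw [abs_of_neg (by linarith)]
        linarith

theorem potential_endpoint {d : ℝ} {w : ℂ → ℂ} (hw : IsWeight d w) {α : ℝ} (hα : 0 < α) :
    potential d w α α = -(2 * d / Real.pi * logDerivReal w α) := by
  rw [potential_of_abs_le hw (abs_of_pos hα).le, rateK, logWeight]
  ring

theorem potential_le_exp {d : ℝ} {w : ℂ → ℂ} (hd : 0 < d) (hw : IsWeight d w) {α : ℝ}
    (hα : 0 < α) (z : ℝ) :
    potential d w α z ≤ potential d w α α * Real.exp (-(Real.pi / (2 * d)) * (z - α)) +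
      0 * Real.exp (Real.pi / (2 * d) * (z - α)) := by
  have h := potential_le_majorant hd hw hα (abs_of_pos hα).le z
  have h2 := potential_endpoint hw hα
  have e1 : (potential d w α α - 2 * d / Real.pi * logDerivReal w α) / 2 = potential d w α α := by
    rw [h2]; ring
  have e2 : (potential d w α α + 2 * d / Real.pi * logDerivReal w α) / 2 = 0 := by
    rw [h2]; ring
  rwa [e1, e2] at h

theorem potential_eq_exp {d : ℝ} {w : ℂ → ℂ} (hw : IsWeight d w) {α z : ℝ}
    (hα : 0 < α) (hz : α ≤ z) :
    potential d w α z = potential d w α α * Real.exp (-(Real.pi / (2 * d)) * (z - α)) +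
      0 * Real.exp (Real.pi / (2 * d) * (z - α)) := by
  have hz' : |z| = z := abs_of_nonneg (by linarith)
  rw [potential_endpoint hw hα, potential_of_le_abs (by rwa [hz']), hz',
    neg_mul (Real.pi / (2 * d)), zero_mul, add_zero]

/-- Inside `[-α, α]` the majorant depends on the point; to the right of `α` one majorant coincides
with the potential. -/
theorem density_nonneg {d : ℝ} {w : ℂ → ℂ} (hd : 0 < d) (hw : IsWeight d w)
    {α : ℝ} (hα : 0 < α) (hF : Integrable (densityFourier d w α)) (x : ℝ) :
    0 ≤ density d w α x := by
  wlog h0 : 0 ≤ x generalizing x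
  · rw [← density_neg hd hw hα hF]
    exact this (-x) (by linarith)
  rcases le_total x α with hx | hx
  · refine density_nonneg_of_majorant hd hw hα hF (y := x) ?_
      (potential_le_majorant hd hw hα (by rwa [abs_of_nonneg h0]))
    simp only [sub_self, mul_zero, Real.exp_zero, mul_one]
    ring
  · exact density_nonneg_of_majorant hd hw hα hF (potential_eq_exp hw hα hx)
      (potential_le_exp hd hw hα)

/-- To the right of the end point the density is at most its value there: it is a sum of
exponential averages of a nonnegative function supported to the left of the end point. -/
theorem density_le_endpoint {d : ℝ} {w : ℂ → ℂ} (hd : 0 < d) (hw : IsWeight d w)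
    {α : ℝ} (hα : 0 < α) (hF : Integrable (densityFourier d w α)) {x : ℝ} (hx : α ≤ x) :
    density d w α x ≤ density d w α α := by
  have hpi := Real.pi_pos
  have h1 := hasSum_expConv_majorant_sub hd hw hα hF (potential_eq_exp hw hα hx)
  have h2 := hasSum_expConv_majorant_sub hd hw hα hF (potential_eq_exp hw hα (le_refl α))
  have h3 := hasSum_le (fun n => ?_) h1 h2
  · have hpd : 0 < Real.pi * d := by positivity
    exact le_of_mul_le_mul_left (by linarith) hpd
  · have hc : 0 < ((n : ℝ) + 1) * (Real.pi / d) := by positivity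
    have hint : ∀ y, Integrable fun z => expKernel (((n : ℝ) + 1) * (Real.pi / d)) (y - z) *
        (potential d w α α * Real.exp (-(Real.pi / (2 * d)) * (z - α)) +
      0 * Real.exp (Real.pi / (2 * d) * (z - α)) - potential d w α z) := by
      intro y
      refine ((expConv_cosh_type hd n (potential d w α α) 0 y α).1.sub
        (integrable_expKernel_mul_potential hd hw α hc y)).congr (Eventually.of_forall fun z => ?_)
      exact (mul_sub _ _ _).symm
    refine integral_mono (hint x) (hint α) fun z => ?_
    rcases le_total α z with hz | hz
    · simp only
      rw [← potential_eq_exp hw hα hz, sub_self, mul_zero, mul_zero]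
    · refine mul_le_mul_of_nonneg_right ?_ (sub_nonneg.2 (potential_le_exp hd hw hα z))
      rw [expKernel, expKernel]
      refine mul_le_mul_of_nonneg_left (Real.exp_le_exp.2 ?_) (by positivity)
      rw [abs_of_nonneg (by linarith), abs_of_nonneg (by linarith)]
      nlinarith

theorem density_le_of_le_on_Icc {d : ℝ} {w : ℂ → ℂ} (hd : 0 < d) (hw : IsWeight d w)
    {α S : ℝ} (hα : 0 < α) (hF : Integrable (densityFourier d w α))
    (hS : ∀ x ∈ Set.Icc (-α) α, |density d w α x| ≤ S) (x : ℝ) : density d w α x ≤ S := by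
  wlog h0 : 0 ≤ x generalizing x
  · rw [← density_neg hd hw hα hF]
    exact this (-x) (by linarith)
  rcases le_total x α with hx | hx
  · exact (le_abs_self _).trans (hS x ⟨by linarith, hx⟩)
  · exact (density_le_endpoint hd hw hα hF hx).trans
      ((le_abs_self _).trans (hS α ⟨by linarith, le_rfl⟩))

/-- Tonelli's theorem: the integral of the potential is the mass of the density times the integral
of the kernel. -/
theorem lintegral_density {d : ℝ} {w : ℂ → ℂ} (hd : 0 < d) (hw : IsWeight d w) {N : ℕ}
    {α : ℝ} (hα : IsEndpoint d w N α) (hF : Integrable (densityFourier d w α)) :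
    ∫⁻ x, ENNReal.ofReal (density d w α x) = ENNReal.ofReal (2 * ((N : ℝ) + 1)) := by
  have hpi := Real.pi_pos
  have hα0 := hα.1
  have hpd : 0 < Real.pi * d := by positivity
  have hν0 := density_nonneg hd hw hα0 hF
  have hνm := (continuous_density hF).measurable
  have h1 : ∫⁻ x, ENNReal.ofReal (potential d w α x) =
      ENNReal.ofReal (Real.pi * d * (2 * ((N : ℝ) + 1))) := by
    rw [← integral_potential hd hw hα, ofReal_integral_eq_lintegral_ofReal
      (integrable_potential hd hw α) (Eventually.of_forall (potential_nonneg hd hw hα0))]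
  have h2 : ∀ x, ENNReal.ofReal (potential d w α x) =
      ∫⁻ z, ENNReal.ofReal (green d (x - z)) * ENNReal.ofReal (density d w α z) := by
    intro x
    rw [← integral_green_mul_density hd hw hα0 hF, ofReal_integral_eq_lintegral_ofReal
      (integrable_kernel_mul_density hF (integrable_green hd) x)
      (Eventually.of_forall fun z => mul_nonneg (green_nonneg _) (hν0 z))]
    exact lintegral_congr fun z => ENNReal.ofReal_mul (green_nonneg _)
  have hgm : Measurable (Function.uncurry fun x z : ℝ =>
      ENNReal.ofReal (green d (x - z)) * ENNReal.ofReal (density d w α z)) := by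
    have := measurable_green d
    fun_prop
  have h3 : ∀ z, ∫⁻ x, ENNReal.ofReal (green d (x - z)) * ENNReal.ofReal (density d w α z) =
      ENNReal.ofReal (Real.pi * d) * ENNReal.ofReal (density d w α z) := by
    intro z
    rw [lintegral_mul_const _ (by have := measurable_green d; fun_prop),
      lintegral_sub_right_eq_self (fun x => ENNReal.ofReal (green d x)) z,
      ← ofReal_integral_eq_lintegral_ofReal (integrable_green hd)
        (Eventually.of_forall green_nonneg), integral_green hd]
  simp only [h2] at h1
  rw [lintegral_lintegral_swap hgm.aemeasurable] at h1
  simp only [h3] at h1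
  rw [lintegral_const_mul _ (by fun_prop), ENNReal.ofReal_mul hpd.le] at h1
  exact (ENNReal.mul_right_inj (by simpa using hpd) ENNReal.ofReal_ne_top).1 h1

theorem integrable_density {d : ℝ} {w : ℂ → ℂ} (hd : 0 < d) (hw : IsWeight d w) {N : ℕ}
    {α : ℝ} (hα : IsEndpoint d w N α) (hF : Integrable (densityFourier d w α)) :
    Integrable (density d w α) := by
  refine ⟨(continuous_density hF).aestronglyMeasurable, ?_⟩
  rw [hasFiniteIntegral_iff_ofReal (Eventually.of_forall (density_nonneg hd hw hα.1 hF)),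
    lintegral_density hd hw hα hF]
  exact ENNReal.ofReal_lt_top

theorem integral_density {d : ℝ} {w : ℂ → ℂ} (hd : 0 < d) (hw : IsWeight d w) {N : ℕ}
    {α : ℝ} (hα : IsEndpoint d w N α) (hF : Integrable (densityFourier d w α)) :
    ∫ x, density d w α x = 2 * ((N : ℝ) + 1) := by
  rw [integral_eq_lintegral_of_nonneg_ae (Eventually.of_forall (density_nonneg hd hw hα.1 hF))
    (continuous_density hF).aestronglyMeasurable, lintegral_density hd hw hα hF,
    ENNReal.toReal_ofReal (by positivity)]

/-! ### Discretisation of the potential -/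

theorem green_le_sub_log {d : ℝ} (hd : 0 < d) {t : ℝ} (ht : t ≠ 0) :
    green d t ≤ Real.pi / (4 * d) * |t| - Real.log (Real.pi / (4 * d) * t) := by
  have hpi := Real.pi_pos
  have hk : 0 < Real.pi / (4 * d) := by positivity
  rw [← green_abs, ← Real.log_abs, abs_mul, abs_of_pos hk, green, tanhStrip]
  have hu : 0 < Real.pi / (4 * d) * |t| := mul_pos hk (abs_pos.2 ht)
  set u := Real.pi / (4 * d) * |t| with hud
  -- `tanh u ≥ u / (1 + u)`
  have h1 : u / (1 + u) ≤ Real.tanh u := by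
    rw [Real.tanh_eq_sinh_div_cosh, Real.sinh_eq, Real.cosh_eq,
        div_div_div_cancel_right₀ (by norm_num),
      div_le_div_iff₀ (by linarith) (by positivity)]
    have h2 : u + 1 ≤ Real.exp u := Real.add_one_le_exp u
    have h3 : 2 * u + 1 ≤ Real.exp (2 * u) := Real.add_one_le_exp (2 * u)
    have h4 : Real.exp (2 * u) * Real.exp (-u) = Real.exp u := by
      rw [← Real.exp_add]; ring_nf
    have h5 := mul_le_mul_of_nonneg_right h3 (Real.exp_pos (-u)).le
    rw [h4] at h5
    linarith
  have h2 := Real.log_le_log (by positivity) h1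
  rw [Real.log_div hu.ne' (by linarith)] at h2
  have h3 : Real.log (1 + u) ≤ u := by
    have := Real.log_le_sub_one_of_pos (by linarith : 0 < 1 + u)
    linarith
  linarith

/-- The logarithmic singularity of the kernel, integrated over a neighbourhood of size `1/S`. -/
theorem integral_green_near_zero_le {d S : ℝ} (hd : 0 < d) (hS : 1 ≤ S) :
    S * ∫ t in (-(4 * d / Real.pi / S))..(4 * d / Real.pi / S), green d t ≤
      4 * d / Real.pi * (4 + 2 * Real.log S) := by
  have hpi := Real.pi_pos
  have hS0 : 0 < S := by linarith
  set δ := 4 * d / Real.pi / S with hδ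
  have hδ0 : 0 < δ := by positivity
  set k := Real.pi / (4 * d) with hk
  have hk0 : 0 < k := by positivity
  have hkδ : k * δ = 1 / S := by rw [hk, hδ]; field_simp
  have hlogi : IntervalIntegrable (fun t => Real.log (k * t)) volume (-δ) δ := by
    have h := intervalIntegral.intervalIntegrable_log' (a := k * -δ) (b := k * δ)
    have h2 := h.comp_mul_left (c := k)
    rwa [mul_div_cancel_left₀ _ hk0.ne', mul_div_cancel_left₀ _ hk0.ne'] at h2
  have h1 : ∫ t in (-δ)..δ, green d t ≤ ∫ t in (-δ)..δ, (1 - Real.log (k * t)) := by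
    refine intervalIntegral.integral_mono_on (by linarith)
      (integrable_green hd).intervalIntegrable
      (intervalIntegrable_const.sub hlogi) fun t ht => ?_
    rcases eq_or_ne t 0 with rfl | h0
    · simp [green, tanhStrip_zero]
    · have h2 := green_le_sub_log hd h0
      have h3 : k * |t| ≤ k * δ := mul_le_mul_of_nonneg_left (abs_le.2 ht) hk0.le
      have h4 : 1 / S ≤ 1 := by rw [div_le_one hS0]; exact hS
      linarith
  have h2 : ∫ t in (-δ)..δ, (1 - Real.log (k * t)) = k⁻¹ * (1 / S * (4 + 2 * Real.log S)) := by
    rw [intervalIntegral.integral_sub intervalIntegrable_const hlogi,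
      intervalIntegral.integral_comp_mul_left _ hk0.ne', integral_log, mul_neg, hkδ,
      Real.log_neg_eq_log, intervalIntegral.integral_const, one_div, Real.log_inv]
    have hδ' : δ = k⁻¹ * S⁻¹ := by
      rw [← one_div S, ← hkδ]; field_simp
    simp only [smul_eq_mul]
    rw [hδ']
    ring
  have h3 : k⁻¹ = 4 * d / Real.pi := by rw [hk, inv_div]
  calc S * ∫ t in (-δ)..δ, green d t ≤ S * (k⁻¹ * (1 / S * (4 + 2 * Real.log S))) :=
        mul_le_mul_of_nonneg_left (h1.trans_eq h2) hS0.le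
    _ = _ := by rw [h3]; field_simp

/-- A set of mass at most one carries potential of size `O(log S)`, where `S` bounds the density:
inside the distance `4d/(πS)` the bound `S` is used, outside it the monotonicity of the kernel. -/
theorem setIntegral_green_mul_le {d S : ℝ} (hd : 0 < d) (hS : 1 ≤ S) {ν : ℝ → ℝ}
    (hν0 : ∀ z, 0 ≤ ν z) (hνS : ∀ z, ν z ≤ S) (hν : Integrable ν) {x : ℝ}
    (hi : Integrable fun z => green d (x - z) * ν z) (J : Set ℝ) (hJ : ∫ z in J, ν z ≤ 1) :
    ∫ z in J, green d (x - z) * ν z ≤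
      1 + Real.log S + 4 * d / Real.pi * (4 + 2 * Real.log S) := by
  have hpi := Real.pi_pos
  have hS0 : 0 < S := by linarith
  set δ := 4 * d / Real.pi / S with hδ
  have hδ0 : 0 < δ := by positivity
  have hδg : green d δ ≤ 1 + Real.log S := by
    have h := green_le_sub_log hd hδ0.ne'
    have h2 : Real.pi / (4 * d) * δ = 1 / S := by rw [hδ]; field_simp
    rw [abs_of_pos hδ0, h2, one_div, Real.log_inv] at h
    have h4 : S⁻¹ ≤ 1 := inv_le_one_of_one_le₀ hS
    linarith
  set near : ℝ → ℝ := (Set.Ioc (-δ) δ).indicator (green d) with hnear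
  have hni : Integrable near := (integrable_green hd).indicator measurableSet_Ioc
  have hn0 : ∀ t, 0 ≤ near t := fun t => Set.indicator_nonneg (fun t _ => green_nonneg t) t
  have hpt : ∀ z, green d (x - z) * ν z ≤ green d δ * ν z + S * near (x - z) := by
    intro z
    by_cases hz : x - z ∈ Set.Ioc (-δ) δ
    · simp only [hnear]
      rw [Set.indicator_of_mem hz]
      have h1 := mul_le_mul_of_nonneg_left (hνS z) (green_nonneg (d := d) (x - z))
      have h2 := mul_nonneg (green_nonneg (d := d) δ) (hν0 z)
      linarith
    · have h1 : |δ| ≤ |x - z| := by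
        rw [abs_of_pos hδ0]
        by_contra! h
        exact hz ⟨(abs_lt.1 h).1, (abs_lt.1 h).2.le⟩
      have h2 := mul_le_mul_of_nonneg_right (green_anti hd hδ0.ne' h1) (hν0 z)
      have h3 := mul_nonneg hS0.le (hn0 (x - z))
      linarith
  have hni' : Integrable fun z => S * near (x - z) := (hni.comp_sub_left x).const_mul S
  calc ∫ z in J, green d (x - z) * ν z ≤ ∫ z in J, (green d δ * ν z + S * near (x - z)) :=
        integral_mono hi.restrict ((hν.const_mul _).add hni').restrict hpt
    _ = green d δ * (∫ z in J, ν z) + ∫ z in J, S * near (x - z) := by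
        rw [integral_add (hν.const_mul _).restrict hni'.restrict, integral_const_mul]
    _ ≤ green d δ * 1 + ∫ z, S * near (x - z) := by
        refine add_le_add (mul_le_mul_of_nonneg_left hJ (green_nonneg _)) ?_
        exact setIntegral_le_integral hni' (Eventually.of_forall fun z => mul_nonneg hS0.le (hn0 _))
    _ = green d δ + S * ∫ t in (-δ)..δ, green d t := by
        rw [mul_one, integral_const_mul, integral_sub_left_eq_self near, hnear,
          integral_indicator measurableSet_Ioc, intervalIntegral.integral_of_le (by linarith)]
    _ ≤ _ := add_le_add hδg (integral_green_near_zero_le hd hS)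

/-- A density on the line with total mass `2(N + 1)` and points that cut off masses `N + 1 ± i`
on both sides: the hypotheses under which the potential is discretised. -/
structure QuantileData (N : ℕ) (ν : ℝ → ℝ) (a : ℤ → ℝ) : Prop where
  nonneg : ∀ z, 0 ≤ ν z
  integrable : Integrable ν
  right : ∀ i ∈ Finset.Icc (-(N : ℤ)) N, ∫ z in Set.Ioi (a i), ν z = (N : ℝ) + 1 - i
  left : ∀ i ∈ Finset.Icc (-(N : ℤ)) N, ∫ z in Set.Iic (a i), ν z = (N : ℝ) + 1 + i

theorem QuantileData.lt {N : ℕ} {ν : ℝ → ℝ} {a : ℤ → ℝ} (h : QuantileData N ν a) {i j : ℤ}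
    (hi : i ∈ Finset.Icc (-(N : ℤ)) N) (hj : j ∈ Finset.Icc (-(N : ℤ)) N) (hij : i < j) :
    a i < a j := by
  by_contra! hle
  have h1 : ∫ z in Set.Iic (a j), ν z ≤ ∫ z in Set.Iic (a i), ν z :=
    setIntegral_mono_set h.integrable.integrableOn (Eventually.of_forall h.nonneg)
      (Set.Iic_subset_Iic.2 hle).eventuallyLE
  rw [h.left i hi, h.left j hj] at h1
  have : (i : ℝ) < j := by exact_mod_cast hij
  linarith

theorem QuantileData.cell {N : ℕ} {ν : ℝ → ℝ} {a : ℤ → ℝ} (h : QuantileData N ν a) {i : ℤ}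
    (hi : i ∈ Finset.Icc (-(N : ℤ)) N) (hj : i + 1 ∈ Finset.Icc (-(N : ℤ)) N) :
    ∫ z in Set.Ioc (a i) (a (i + 1)), ν z = 1 := by
  have hlt := h.lt hi hj (by omega)
  have h1 := setIntegral_union (μ := volume) (f := ν) (Set.Iic_disjoint_Ioc (le_refl (a i)))
    (measurableSet_Ioc (b := a (i + 1))) h.integrable.integrableOn h.integrable.integrableOn
  rw [Set.Iic_union_Ioc_eq_Iic hlt.le, h.left i hi, h.left (i + 1) hj] at h1
  push_cast at h1
  linarith

theorem setIntegral_green_mul_le_of_le {d x g : ℝ} {ν : ℝ → ℝ} (hν0 : ∀ z, 0 ≤ ν z)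
    (hν : Integrable ν) (hi : Integrable fun z => green d (x - z) * ν z) {J : Set ℝ}
    (hJ : MeasurableSet J) (hg : ∀ z ∈ J, green d (x - z) ≤ g) :
    ∫ z in J, green d (x - z) * ν z ≤ g * ∫ z in J, ν z := by
  rw [← integral_const_mul]
  exact setIntegral_mono_on hi.integrableOn (hν.const_mul g).integrableOn hJ fun z hz =>
    mul_le_mul_of_nonneg_right (hg z hz) (hν0 z)

/-- The potential of the mass to the right of `a k > x`, cell by cell: the mass of the last cell
`(a N, ∞)` is one as well. -/
theorem QuantileData.right_le {d : ℝ} (hd : 0 < d) {N : ℕ} {ν : ℝ → ℝ} {a : ℤ → ℝ}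
    (h : QuantileData N ν a) {x : ℝ} (hi : Integrable fun z => green d (x - z) * ν z) {k : ℤ}
    (hk : k ∈ Finset.Icc (-(N : ℤ)) N) (hx : x < a k) :
    ∫ z in Set.Ioi (a k), green d (x - z) * ν z ≤ ∑ m ∈ Finset.Icc k N, green d (x - a m) := by
  obtain ⟨n, hn⟩ : ∃ n : ℕ, k + n = N :=
    ⟨(N - k).toNat, by have := (Finset.mem_Icc.1 hk).2; omega⟩
  have hmono : ∀ k : ℤ, x < a k → ∀ z, a k < z → green d (x - z) ≤ green d (x - a k) := by
    intro k hx z hz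
    refine green_anti hd (by linarith) ?_
    rw [abs_of_neg (by linarith), abs_of_neg (by linarith)]
    linarith
  induction n generalizing k with
  | zero =>
    have hkN : k = N := by simpa using hn
    have h1 := setIntegral_green_mul_le_of_le (d := d) h.nonneg h.integrable hi measurableSet_Ioi
      (hmono k hx)
    rw [h.right k hk, hkN] at h1
    rw [hkN, Finset.Icc_self, Finset.sum_singleton]
    refine h1.trans_eq ?_
    push_cast
    ring
  | succ n ih =>
    have hk1 : k + 1 ∈ Finset.Icc (-(N : ℤ)) N := by
      rw [Finset.mem_Icc] at hk ⊢
      push_cast at hn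
      omega
    have hlt := h.lt hk hk1 (by omega)
    have h1 := ih hk1 (hx.trans hlt) (by push_cast at hn; omega)
    have h2 := setIntegral_green_mul_le_of_le (d := d) h.nonneg h.integrable hi
      (measurableSet_Ioc (a := a k) (b := a (k + 1))) fun z hz => hmono k hx z hz.1
    rw [h.cell hk hk1, mul_one] at h2
    have hkN : k ≤ N := (Finset.mem_Icc.1 hk).2
    have h3 : Finset.Icc k (N : ℤ) = insert k (Finset.Icc (k + 1) N) := by
      ext m
      simp only [Finset.mem_Icc, Finset.mem_insert]
      omega
    rw [h3, Finset.sum_insert (by simp), ← Set.Ioc_union_Ioi_eq_Ioi hlt.le,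
      setIntegral_union (Set.Ioc_disjoint_Ioi (le_refl _)) measurableSet_Ioi hi.integrableOn
        hi.integrableOn]
    exact add_le_add h2 h1

/-- The mirror image of `QuantileData.right_le`. -/
theorem QuantileData.left_le {d : ℝ} (hd : 0 < d) {N : ℕ} {ν : ℝ → ℝ} {a : ℤ → ℝ}
    (h : QuantileData N ν a) {x : ℝ} (hi : Integrable fun z => green d (x - z) * ν z) {k : ℤ}
    (hk : k ∈ Finset.Icc (-(N : ℤ)) N) (hx : a k < x) :
    ∫ z in Set.Iic (a k), green d (x - z) * ν z ≤
      ∑ m ∈ Finset.Icc (-(N : ℤ)) k, green d (x - a m) := by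
  obtain ⟨n, hn⟩ : ∃ n : ℕ, k = -(N : ℤ) + n :=
    ⟨(k + N).toNat, by have := (Finset.mem_Icc.1 hk).1; omega⟩
  have hmono : ∀ k : ℤ, a k < x → ∀ z, z ≤ a k → green d (x - z) ≤ green d (x - a k) := by
    intro k hx z hz
    refine green_anti hd (by linarith) ?_
    rw [abs_of_pos (by linarith), abs_of_pos (by linarith)]
    linarith
  induction n generalizing k with
  | zero =>
    have hkN : k = -(N : ℤ) := by simpa using hn
    have h1 := setIntegral_green_mul_le_of_le (d := d) h.nonneg h.integrable hi measurableSet_Iic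
      (hmono k hx)
    rw [h.left k hk, hkN] at h1
    rw [hkN, Finset.Icc_self, Finset.sum_singleton]
    refine h1.trans_eq ?_
    push_cast
    ring
  | succ n ih =>
    obtain ⟨j, rfl⟩ : ∃ j, k = j + 1 := ⟨k - 1, by ring⟩
    have hj : j ∈ Finset.Icc (-(N : ℤ)) N := by
      rw [Finset.mem_Icc] at hk ⊢
      push_cast at hn
      omega
    have hlt := h.lt hj hk (by omega)
    have h1 := ih hj (hlt.trans hx) (by push_cast at hn; omega)
    have h2 := setIntegral_green_mul_le_of_le (d := d) h.nonneg h.integrable hi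
      (measurableSet_Ioc (a := a j) (b := a (j + 1))) fun z hz => hmono (j + 1) hx z hz.2
    rw [h.cell hj hk, mul_one] at h2
    have hjN : -(N : ℤ) ≤ j := (Finset.mem_Icc.1 hj).1
    have h3 : Finset.Icc (-(N : ℤ)) (j + 1) = insert (j + 1) (Finset.Icc (-(N : ℤ)) j) := by
      ext m
      simp only [Finset.mem_Icc, Finset.mem_insert]
      omega
    rw [h3, Finset.sum_insert (by simp), ← Set.Iic_union_Ioc_eq_Iic hlt.le,
      setIntegral_union (Set.Iic_disjoint_Ioc (le_refl _)) measurableSet_Ioc hi.integrableOn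
        hi.integrableOn]
    linarith

/-- Each cell between neighbouring points has mass one; moving its mass to the end point nearer
to `x` increases the potential. Only the cell containing `x` has to be estimated separately. -/
theorem QuantileData.potential_le {d : ℝ} (hd : 0 < d) {N : ℕ} {ν : ℝ → ℝ} {a : ℤ → ℝ}
    (h : QuantileData N ν a) {x : ℝ} (hi : Integrable fun z => green d (x - z) * ν z)
    (hx : ∀ m ∈ Finset.Icc (-(N : ℤ)) N, x ≠ a m) {R : ℝ}
    (hR : ∀ J : Set ℝ, ∫ z in J, ν z ≤ 1 → ∫ z in J, green d (x - z) * ν z ≤ R) :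
    ∫ z, green d (x - z) * ν z ≤ ∑ m ∈ Finset.Icc (-(N : ℤ)) N, green d (x - a m) + R := by
  have hsplit : ∀ t, ∫ z, green d (x - z) * ν z =
      (∫ z in Set.Iic t, green d (x - z) * ν z) + ∫ z in Set.Ioi t, green d (x - z) * ν z :=
    fun t => (intervalIntegral.integral_Iic_add_Ioi hi.integrableOn hi.integrableOn).symm
  have hmemN : (N : ℤ) ∈ Finset.Icc (-(N : ℤ)) N := by
    rw [Finset.mem_Icc]; omega
  have hmemN' : -(N : ℤ) ∈ Finset.Icc (-(N : ℤ)) N := by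
    rw [Finset.mem_Icc]; omega
  rcases lt_or_gt_of_ne (hx _ hmemN') with h1 | h1
  · rw [hsplit (a (-N))]
    have h2 := h.right_le hd hi hmemN' h1
    have h3 := hR (Set.Iic (a (-N))) (by rw [h.left _ hmemN']; push_cast; linarith)
    linarith
  · obtain ⟨j, hjm, hjmax⟩ := Finset.exists_max_image
      ((Finset.Icc (-(N : ℤ)) N).filter fun m => a m < x) id
      ⟨-(N : ℤ), Finset.mem_filter.2 ⟨hmemN', h1⟩⟩
    obtain ⟨hj, hjx⟩ := Finset.mem_filter.1 hjm
    have h2 := h.left_le hd hi hj hjx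
    rw [hsplit (a j)]
    rcases eq_or_ne j N with rfl | hjN
    · have h3 := hR (Set.Ioi (a N)) (by rw [h.right _ hmemN]; push_cast; linarith)
      linarith
    · have hj1 : j + 1 ∈ Finset.Icc (-(N : ℤ)) N := by
        rw [Finset.mem_Icc] at hj ⊢
        omega
      have hxj : x < a (j + 1) := by
        refine lt_of_le_of_ne ?_ (hx _ hj1)
        by_contra! hlt
        have := hjmax (j + 1) (Finset.mem_filter.2 ⟨hj1, hlt⟩)
        simp only [id] at this
        omega
      have hlt := hjx.trans hxj
      have h3 := h.right_le hd hi hj1 hxj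
      have h4 := hR (Set.Ioc (a j) (a (j + 1))) (h.cell hj hj1).le
      rw [← Set.Ioc_union_Ioi_eq_Ioi hlt.le,
        setIntegral_union (Set.Ioc_disjoint_Ioi (le_refl _)) measurableSet_Ioi hi.integrableOn
          hi.integrableOn]
      have h5 : ∑ m ∈ Finset.Icc (-(N : ℤ)) N, green d (x - a m) =
          ∑ m ∈ Finset.Icc (-(N : ℤ)) j, green d (x - a m) +
            ∑ m ∈ Finset.Icc (j + 1) N, green d (x - a m) := by
        rw [← Finset.sum_union]
        · congr 1
          ext m
          rw [Finset.mem_Icc] at hj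
          simp only [Finset.mem_Icc, Finset.mem_union]
          omega
        · rw [Finset.disjoint_left]
          intro m hm hm'
          rw [Finset.mem_Icc] at hm hm'
          omega
      linarith

theorem quantileData_density {d : ℝ} {w : ℂ → ℂ} (hd : 0 < d) (hw : IsWeight d w) {N : ℕ}
    {α : ℝ} (hα : IsEndpoint d w N α) (hF : Integrable (densityFourier d w α)) {a : ℤ → ℝ}
    (ha : IsSampling d w N α a) : QuantileData N (density d w α) a := by
  have hi := integrable_density hd hw hα hF
  have htot := integral_density hd hw hα hF
  have hsplit : ∀ t, (∫ z in Set.Iic t, density d w α z) + ∫ z in Set.Ioi t, density d w α z =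
      2 * ((N : ℝ) + 1) := fun t => by
    rw [← htot]
    exact intervalIntegral.integral_Iic_add_Ioi hi.integrableOn hi.integrableOn
  have hsymm : ∫ z in Set.Iic (0 : ℝ), density d w α z = ∫ z in Set.Ioi (0 : ℝ),
      density d w α z := by
    have h1 := integral_comp_neg_Iic 0 (density d w α)
    simp only [density_neg hd hw hα.1 hF, neg_zero] at h1
    exact h1
  have hhalf : ∫ z in Set.Ioi (0 : ℝ), density d w α z = (N : ℝ) + 1 := by
    have := hsplit 0
    linarith
  have hright : ∀ i ∈ Finset.Icc (-(N : ℤ)) N,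
      ∫ z in Set.Ioi (a i), density d w α z = (N : ℝ) + 1 - i := by
    intro i him
    have h1 := intervalIntegral.integral_interval_add_Ioi (a := 0) (b := a i)
      (hi.integrableOn (s := Set.Ioi (0 : ℝ))) (hi.integrableOn (s := Set.Ioi (a i)))
    have h2 := ha i him
    rw [densityIntegral] at h2
    rw [h2, hhalf] at h1
    linarith
  refine ⟨density_nonneg hd hw hα.1 hF, hi, hright, fun i him => ?_⟩
  have h1 := hsplit (a i)
  rw [hright i him] at h1
  linarith

/-- Equality holds on `[-α, α]`; outside, the tangent at the end point lies above `log w`. -/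
theorem logWeight_le_potential {d : ℝ} {w : ℂ → ℂ} (hd : 0 < d) (hw : IsWeight d w) {α : ℝ}
    (hα : 0 < α) (x : ℝ) : logWeight w x ≤ potential d w α x - rateK d w α := by
  rcases le_total |x| α with hx | hx
  · rw [potential_of_abs_le hw hx]
    linarith
  · have hpi := Real.pi_pos
    rw [potential_of_le_abs hx, rateK, ← logWeight_abs hw]
    have h1 := logWeight_le_tangent hd hw α |x|
    have h2 := logDerivReal_nonpos hd hw hα.le
    -- `L t ≤ (2d/π) L (1 - exp(-πt/(2d)))`, as `L ≤ 0` and `1 - exp(-s) ≤ s`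
    have h3 := Real.add_one_le_exp (-(Real.pi / (2 * d) * (|x| - α)))
    have h4 : 0 ≤ -(2 * d / Real.pi * logDerivReal w α) := neg_mul_logDerivReal_nonneg hd hw hα
    have h5 := mul_le_mul_of_nonneg_left h3 h4
    have h6 : -(2 * d / Real.pi * logDerivReal w α) * (-(Real.pi / (2 * d) * (|x| - α)) + 1) =
        logDerivReal w α * (|x| - α) - 2 * d / Real.pi * logDerivReal w α := by
      field_simp
      ring
    rw [logWeight, logWeight] at h1
    rw [logWeight]
    linarith

/-- The weighted Blaschke product of the sampling points decays like `exp(-K)` up to a power of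
the bound for the density. -/
theorem weight_mul_prod_tanh_le {d : ℝ} {w : ℂ → ℂ} (hd : 0 < d) (hw : IsWeight d w) {N : ℕ}
    {α : ℝ} (hα : IsEndpoint d w N α) (hF : Integrable (densityFourier d w α)) {a : ℤ → ℝ}
    (ha : IsSampling d w N α a) {S : ℝ} (hS : 1 ≤ S)
    (hνS : ∀ x ∈ Set.Icc (-α) α, |density d w α x| ≤ S) {x : ℝ}
    (hx : ∀ m ∈ Finset.Icc (-(N : ℤ)) N, x ≠ a m) :
    realPart w x * ∏ m ∈ Finset.Icc (-(N : ℤ)) N, |tanhStrip d (x - a m)| ≤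
      Real.exp (1 + 16 * d / Real.pi) * S ^ (1 + 8 * d / Real.pi) * Real.exp (-rateK d w α) := by
  have hpi := Real.pi_pos
  have hS0 : 0 < S := by linarith
  have hq := quantileData_density hd hw hα hF ha
  have hi := integrable_kernel_mul_density hF (integrable_green hd) x
  have h1 := hq.potential_le hd hi hx fun J hJ => setIntegral_green_mul_le hd hS hq.nonneg
    (density_le_of_le_on_Icc hd hw hα.1 hF hνS) hq.integrable hi J hJ
  rw [integral_green_mul_density hd hw hα.1 hF] at h1
  have h2 := logWeight_le_potential hd hw hα.1 x
  have hT : ∀ m ∈ Finset.Icc (-(N : ℤ)) N, |tanhStrip d (x - a m)| ≠ 0 := by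
    intro m hm h0
    rw [abs_eq_zero, ← tanhStrip_zero d] at h0
    exact hx m hm (sub_eq_zero.1 ((tanhStrip_strictMono hd).injective h0))
  have hP : 0 < ∏ m ∈ Finset.Icc (-(N : ℤ)) N, |tanhStrip d (x - a m)| :=
    Finset.prod_pos fun m hm => lt_of_le_of_ne (abs_nonneg _) (hT m hm).symm
  have hwx : 0 < realPart w x := (hw.real_pos x).2
  rw [← Real.exp_log (mul_pos hwx hP), Real.log_mul hwx.ne' hP.ne', Real.log_prod hT,
    Real.rpow_def_of_pos hS0, ← Real.exp_add, ← Real.exp_add]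
  refine Real.exp_le_exp.2 ?_
  have h3 : ∑ m ∈ Finset.Icc (-(N : ℤ)) N, Real.log |tanhStrip d (x - a m)| =
      -∑ m ∈ Finset.Icc (-(N : ℤ)) N, green d (x - a m) := by
    rw [← Finset.sum_neg_distrib]
    exact Finset.sum_congr rfl fun m _ => by rw [green, neg_neg, Real.log_abs]
  rw [h3]
  rw [logWeight] at h2
  have h4 : 1 + Real.log S + 4 * d / Real.pi * (4 + 2 * Real.log S) =
      1 + 16 * d / Real.pi + Real.log S * (1 + 8 * d / Real.pi) := by ring
  linarith

/-! ### Interpolation in the unit disc -/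

/-- Partial fractions of `∏ (1 - s_j z) / (z ∏ (z - s_j))`, a Lagrange interpolation identity at
the nodes `0` and `s_j`. -/
theorem blaschke_partial_fractions {ι : Type*} [DecidableEq ι] (S : Finset ι) (s : ι → ℂ)
    (hinj : Set.InjOn s S) (h0 : ∀ i ∈ S, s i ≠ 0) {z : ℂ} (hz : z ≠ 0) (hzs : ∀ i ∈ S, z ≠ s i) :
    z⁻¹ * ∏ i ∈ S, (1 - s i * z) / (z - s i) =
      z⁻¹ * ∏ i ∈ S, (-s i)⁻¹ + ∑ j ∈ S, (z - s j)⁻¹ *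
        ((s j)⁻¹ * (1 - s j * s j) * ∏ i ∈ S.erase j, (1 - s i * s j) / (s j - s i)) := by
  classical
  set v : Option ι → ℂ := fun o => o.elim 0 s with hv
  set T : Finset (Option ι) := Finset.insertNone S with hT
  set p : Polynomial ℂ := ∏ i ∈ S, (1 - Polynomial.C (s i) * Polynomial.X) with hp
  have hTS : T = insert none (S.map Function.Embedding.some) := by
    ext o; cases o <;> simp [hT]
  have hn : none ∉ S.map Function.Embedding.some := by simp
  have hvi : Set.InjOn v T := by
    rintro (_ | i) hi (_ | j) hj hij
    · rfl
    · exact absurd hij.symm (h0 j (by simpa [hT] using hj))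
    · exact absurd hij (h0 i (by simpa [hT] using hi))
    · exact congrArg some (hinj (by simpa [hT] using hi) (by simpa [hT] using hj) hij)
  have hdeg : p.degree < T.card := by
    rw [hT, Finset.card_insertNone]
    calc p.degree ≤ ∑ i ∈ S, (1 - Polynomial.C (s i) * Polynomial.X : Polynomial ℂ).degree :=
          Polynomial.degree_prod_le _ _
      _ ≤ ∑ i ∈ S, 1 := Finset.sum_le_sum fun i _ => by
          refine (Polynomial.degree_sub_le _ _).trans (max_le ?_ ?_)
          · exact Polynomial.degree_one_le.trans (by norm_num)
          · exact Polynomial.degree_C_mul_X_le _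
      _ < ((S.card + 1 : ℕ) : WithBot ℕ) := by
          simp only [Finset.sum_const, nsmul_eq_mul, mul_one]
          exact_mod_cast Nat.lt_succ_self _
  have hpe : ∀ y, p.eval y = ∏ i ∈ S, (1 - s i * y) := fun y => by
    simp [hp, Polynomial.eval_prod]
  have hzv : ∀ o ∈ T, z ≠ v o := by
    rintro (_ | i) hi
    · exact hz
    · exact hzs i (by simpa [hT] using hi)
  have key := Lagrange.eval_interpolate_not_at_node (fun o => p.eval (v o)) hzv
  rw [← Lagrange.eq_interpolate hvi hdeg, hpe, Lagrange.eval_nodal, hTS, Finset.prod_insert hn,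
    Finset.sum_insert hn, Finset.prod_map, Finset.sum_map] at key
  have hv0 : v none = 0 := rfl
  have hvs : ∀ i, v (some i) = s i := fun i => rfl
  simp only [Function.Embedding.some_apply, hv0, hvs] at key
  have hprod : ∏ i ∈ S, (z - s i) ≠ 0 := Finset.prod_ne_zero_iff.2 fun i hi =>
      sub_ne_zero.2 (hzs i hi)
  rw [Finset.prod_div_distrib, key, sub_zero, mul_assoc, mul_div_assoc, ← mul_assoc z⁻¹,
    inv_mul_cancel₀ hz, one_mul, mul_div_cancel_left₀ _ hprod]
  congr 1
  · simp only [Lagrange.nodalWeight, hpe, hv0, hvs, Finset.erase_insert hn, Finset.prod_map,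
      mul_zero,
      sub_zero, Finset.prod_const_one, mul_one, Function.Embedding.some_apply, zero_sub]
    rw [mul_comm]
  · refine Finset.sum_congr rfl fun j hj => ?_
    have he : (insert none (S.map Function.Embedding.some)).erase (some j) =
        insert none ((S.erase j).map Function.Embedding.some) := by
      ext o; cases o <;> simp
    rw [Lagrange.nodalWeight, he, Finset.prod_insert (by simp), Finset.prod_map, hpe,
      ← Finset.mul_prod_erase S _ hj, Finset.prod_div_distrib]
    simp only [Function.Embedding.some_apply, hv0, hvs, sub_zero, Finset.prod_inv_distrib]
    ring

/-- The interpolation of a bounded analytic function at real points of the disc by the residues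
of `g(z) / (z B(z))`, where `B` is the Blaschke product of the nodes: the error at the origin is
at most `M |B(0)|`. -/
theorem disc_interpolation_error {ι : Type*} [DecidableEq ι] (S : Finset ι) (s : ι → ℝ)
    (hinj : Set.InjOn s S) (h0 : ∀ i ∈ S, s i ≠ 0) (h1 : ∀ i ∈ S, |s i| < 1) {g : ℂ → ℂ} {M : ℝ}
    (hg : DifferentiableOn ℂ g (Metric.ball 0 1)) (hM : ∀ z ∈ Metric.ball (0 : ℂ) 1, ‖g z‖ ≤ M) :
    ‖g 0 - ∑ j ∈ S, g (s j) * (((∏ i ∈ S.erase j, (-s i)) * (1 - s j ^ 2) *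
        ∏ i ∈ S.erase j, (1 - s i * s j) / (s j - s i) : ℝ) : ℂ)‖ ≤ M * ∏ i ∈ S, |s i| := by
  classical
  set E : ℂ := g 0 - ∑ j ∈ S, g (s j) * (((∏ i ∈ S.erase j, (-s i)) * (1 - s j ^ 2) *
        ∏ i ∈ S.erase j, (1 - s i * s j) / (s j - s i) : ℝ) : ℂ) with hE
  have hM0 : 0 ≤ M := (norm_nonneg _).trans (hM 0 (by simp))
  have hP0 : (∏ i ∈ S, (-(s i : ℂ))) ≠ 0 := Finset.prod_ne_zero_iff.2 fun i hi => by
    simpa using h0 i hi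
  have hbound : ∀ r : ℝ, r < 1 → 0 < r → (∀ i ∈ S, |s i| < r) →
      ‖E‖ ≤ M * (∏ i ∈ S, (1 - r * |s i|) / (r - |s i|)) * ∏ i ∈ S, |s i| := by
    intro r hr1 hr0 hrs
    have hsub : Metric.closedBall (0 : ℂ) r ⊆ Metric.ball 0 1 := Metric.closedBall_subset_ball hr1
    have hgd : DifferentiableOn ℂ g (Metric.closedBall 0 r) := hg.mono hsub
    have hcauchy : ∀ t ∈ Metric.ball (0 : ℂ) r,
        (∮ z in C(0, r), (z - t)⁻¹ • g z) = (2 * Real.pi * Complex.I : ℂ) • g t := fun t ht =>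
      hgd.circleIntegral_sub_inv_smul ht
    have hci : ∀ t ∈ Metric.ball (0 : ℂ) r, CircleIntegrable (fun z => (z - t)⁻¹ • g z) 0 r := by
      intro t ht
      refine ContinuousOn.circleIntegrable hr0.le (ContinuousOn.fun_smul ?_ ?_)
      · refine ContinuousOn.inv₀ (by fun_prop) fun z hz => sub_ne_zero.2 ?_
        rintro rfl
        simp only [Metric.mem_ball, Metric.mem_sphere] at ht hz
        exact absurd hz ht.ne
      · exact hgd.continuousOn.mono Metric.sphere_subset_closedBall
    have hmem : ∀ i ∈ S, (s i : ℂ) ∈ Metric.ball (0 : ℂ) r := fun i hi => by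
      simpa using hrs i hi
    have h0mem : (0 : ℂ) ∈ Metric.ball (0 : ℂ) r := by simpa using hr0
    set k : ι → ℂ := fun j => (s j : ℂ)⁻¹ * (1 - s j * s j) *
      ∏ i ∈ S.erase j, (1 - (s i : ℂ) * s j) / (s j - s i) with hk
    set k0 : ℂ := ∏ i ∈ S, (-(s i : ℂ))⁻¹ with hk0
    have hsph : ∀ z ∈ Metric.sphere (0 : ℂ) r,
        (z⁻¹ * ∏ i ∈ S, (1 - s i * z) / (z - s i)) • g z =
          k0 • ((z - 0)⁻¹ • g z) + ∑ j ∈ S, k j • ((z - s j)⁻¹ • g z) := by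
      intro z hz
      have hzr : ‖z‖ = r := by simpa using hz
      have hz0 : z ≠ 0 := by
        rintro rfl
        simp at hzr; linarith
      have hzs : ∀ i ∈ S, z ≠ s i := by
        rintro i hi rfl
        have := hrs i hi
        simp at hzr; linarith
      rw [blaschke_partial_fractions S (fun i => (s i : ℂ))
        (fun a ha b hb hab => hinj ha hb (Complex.ofReal_injective hab))
        (fun i hi => by exact_mod_cast h0 i hi) hz0 hzs]
      simp only [smul_eq_mul, sub_zero]
      rw [add_mul, Finset.sum_mul]
      congr 1
      · rw [hk0]; ring
      · exact Finset.sum_congr rfl fun j _ => by rw [hk]; ring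
    have hint : (∮ z in C(0, r), (z⁻¹ * ∏ i ∈ S, (1 - s i * z) / (z - s i)) • g z) =
        (2 * Real.pi * Complex.I : ℂ) * (k0 * g 0 + ∑ j ∈ S, k j * g (s j)) := by
      rw [circleIntegral.integral_congr hr0.le hsph, circleIntegral.integral_add,
        circleIntegral.integral_fun_sum]
      · rw [circleIntegral.integral_smul, hcauchy 0 h0mem]
        simp_rw [circleIntegral.integral_smul]
        rw [Finset.sum_congr rfl fun j hj => by rw [hcauchy _ (hmem j hj)]]
        simp only [smul_eq_mul]
        rw [mul_add, Finset.mul_sum]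
        congr 1
        · ring
        · exact Finset.sum_congr rfl fun j _ => by ring
      · exact fun j hj => (hci _ (hmem j hj)).const_fun_smul
      · exact (hci 0 h0mem).const_fun_smul
      · exact CircleIntegrable.fun_sum S fun j hj => (hci _ (hmem j hj)).const_fun_smul
    have hEk : E = (∏ i ∈ S, (-(s i : ℂ))) * (k0 * g 0 + ∑ j ∈ S, k j * g (s j)) := by
      rw [mul_add, ← mul_assoc, hk0, Finset.prod_inv_distrib, mul_inv_cancel₀ hP0, one_mul, hE,
        sub_eq_add_neg, ← Finset.sum_neg_distrib, Finset.mul_sum]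
      congr 1
      refine Finset.sum_congr rfl fun j hj => ?_
      have hj0 : (s j : ℂ) ≠ 0 := by exact_mod_cast h0 j hj
      rw [hk, ← Finset.mul_prod_erase S _ hj]
      push_cast
      field_simp
    have hnorm : ‖∮ z in C(0, r), (z⁻¹ * ∏ i ∈ S, (1 - s i * z) / (z - s i)) • g z‖ ≤
        2 * Real.pi * r * (r⁻¹ * (∏ i ∈ S, (1 - r * |s i|) / (r - |s i|)) * M) := by
      refine circleIntegral.norm_integral_le_of_norm_le_const hr0.le fun z hz => ?_
      have hzr : ‖z‖ = r := by simpa using hz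
      rw [norm_smul, norm_mul, norm_inv, hzr, norm_prod]
      refine mul_le_mul (mul_le_mul_of_nonneg_left ?_ (by positivity))
        (hM z (hsub (Metric.sphere_subset_closedBall hz))) (norm_nonneg _) ?_
      · refine Finset.prod_le_prod (fun i _ => norm_nonneg _) fun i hi => ?_
        have ha := hrs i hi
        have ha1 := h1 i hi
        have hsz : |s i| < ‖z‖ := by rw [hzr]; exact ha
        have hzne : 0 < ‖z - s i‖ := by
          refine norm_pos_iff.2 (sub_ne_zero.2 ?_)
          rintro rfl
          simp at hsz
        rw [norm_div, div_le_div_iff₀ hzne (by linarith)]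
        -- both sides are squared: the difference is a nonnegative multiple of `1 - s²`
        have e1 : ‖1 - s i * z‖ ^ 2 = 1 - 2 * s i * z.re + s i ^ 2 * r ^ 2 := by
          rw [← hzr, ← Complex.normSq_eq_norm_sq, ← Complex.normSq_eq_norm_sq,
            Complex.normSq_apply, Complex.normSq_apply]
          simp
          ring
        have e2 : ‖z - s i‖ ^ 2 = r ^ 2 - 2 * s i * z.re + s i ^ 2 := by
          rw [← hzr, ← Complex.normSq_eq_norm_sq, ← Complex.normSq_eq_norm_sq,
            Complex.normSq_apply, Complex.normSq_apply]
          simp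
          ring
        have hre : s i * z.re ≤ |s i| * r := by
          calc s i * z.re ≤ |s i * z.re| := le_abs_self _
            _ = |s i| * |z.re| := abs_mul _ _
            _ ≤ |s i| * r := by
              rw [← hzr]
              exact mul_le_mul_of_nonneg_left (Complex.abs_re_le_norm z) (abs_nonneg _)
        have hra : r * |s i| < 1 := by nlinarith [abs_nonneg (s i)]
        refine abs_le_of_sq_le_sq' ?_ (by
          have : 0 ≤ 1 - r * |s i| := by linarith
          positivity) |>.2
        rw [mul_pow, mul_pow, e1, e2]
        have hq : (s i) ^ 2 = |s i| ^ 2 := (sq_abs _).symm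
        rw [hq]
        set q := |s i| with hqd
        have hq0 : 0 ≤ q := abs_nonneg _
        have : (1 - r * q) ^ 2 * (r ^ 2 - 2 * s i * z.re + q ^ 2) -
            (1 - 2 * s i * z.re + q ^ 2 * r ^ 2) * (r - q) ^ 2 =
            2 * (q * r - s i * z.re) * ((1 - r ^ 2) * (1 - q ^ 2)) := by ring
        have h3 : 0 ≤ (q * r - s i * z.re) * ((1 - r ^ 2) * (1 - q ^ 2)) :=
          mul_nonneg (by linarith) (mul_nonneg (by nlinarith) (by nlinarith))
        linarith
      · refine mul_nonneg (by positivity) (Finset.prod_nonneg fun i hi => ?_)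
        have := hrs i hi
        have := h1 i hi
        exact div_nonneg (by nlinarith [abs_nonneg (s i)]) (by linarith)
    have h2 : ‖k0 * g 0 + ∑ j ∈ S, k j * g (s j)‖ ≤
        (∏ i ∈ S, (1 - r * |s i|) / (r - |s i|)) * M := by
      rw [hint, norm_mul] at hnorm
      have h2pi : ‖(2 * Real.pi * Complex.I : ℂ)‖ = 2 * Real.pi := by
        simp [abs_of_pos Real.pi_pos]
      rw [h2pi, mul_assoc (2 * Real.pi) r] at hnorm
      have := le_of_mul_le_mul_left hnorm (by positivity)
      rwa [← mul_assoc, ← mul_assoc, mul_inv_cancel₀ hr0.ne', one_mul] at this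
    rw [hEk, norm_mul, norm_prod, mul_comm]
    simp only [norm_neg, Complex.norm_real, Real.norm_eq_abs]
    rw [mul_comm M]
    exact mul_le_mul_of_nonneg_right h2 (Finset.prod_nonneg fun i _ => abs_nonneg _)
  have hlim : Tendsto (fun r : ℝ => M * (∏ i ∈ S, (1 - r * |s i|) / (r - |s i|)) * ∏ i ∈ S, |s i|)
      (𝓝[<] 1) (𝓝 (M * (∏ i ∈ S, (1 - 1 * |s i|) / (1 - |s i|)) * ∏ i ∈ S, |s i|)) := by
    refine Tendsto.mul_const _ (Tendsto.const_mul _ (tendsto_finsetProd _ fun i hi => ?_))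
    refine Tendsto.mono_left ?_ nhdsWithin_le_nhds
    refine Tendsto.div ?_ ?_ (by have := h1 i hi; linarith)
    · exact (by fun_prop : Continuous fun r : ℝ => 1 - r * |s i|).tendsto 1
    · exact (by fun_prop : Continuous fun r : ℝ => r - |s i|).tendsto 1
  have hone : ∏ i ∈ S, (1 - 1 * |s i|) / (1 - |s i|) = 1 := Finset.prod_eq_one fun i hi => by
    rw [one_mul, div_self]
    have := h1 i hi
    linarith
  rw [hone, mul_one] at hlim
  refine ge_of_tendsto hlim ?_
  have hev : ∀ᶠ r : ℝ in 𝓝[<] 1, ∀ i ∈ S, |s i| < r :=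
    (Finset.eventually_all S).2 fun i hi =>
      mem_nhdsWithin_of_mem_nhds (Ioi_mem_nhds (h1 i hi))
  filter_upwards [self_mem_nhdsWithin, mem_nhdsWithin_of_mem_nhds (Ioi_mem_nhds zero_lt_one), hev]
    with r hr hr0 hrs
  exact hbound r hr hr0 hrs

/-! ### Interpolation in the strip -/

theorem tanhStrip_sub {d : ℝ} (s t : ℝ) :
    tanhStrip d (s - t) =
        (tanhStrip d s - tanhStrip d t) / (1 - tanhStrip d t * tanhStrip d s) := by
  simp only [tanhStrip, mul_sub, Real.tanh_eq_sinh_div_cosh, Real.sinh_sub, Real.cosh_sub]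
  set u := Real.pi / (4 * d) * s
  set v := Real.pi / (4 * d) * t
  have hu := (Real.cosh_pos u).ne'
  have hv := (Real.cosh_pos v).ne'
  have huv : Real.cosh u * Real.cosh v - Real.sinh u * Real.sinh v ≠ 0 := by
    rw [← Real.cosh_sub]; exact (Real.cosh_pos _).ne'
  have h2 : 1 - Real.sinh v / Real.cosh v * (Real.sinh u / Real.cosh u) =
      (Real.cosh u * Real.cosh v - Real.sinh u * Real.sinh v) / (Real.cosh u * Real.cosh v) := by
    field_simp
  rw [h2]
  field_simp

theorem deriv_tanhStrip {d : ℝ} (hd : 0 < d) (t : ℝ) :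
    4 * d / Real.pi * deriv (tanhStrip d) t = 1 - tanhStrip d t ^ 2 := by
  have hpi := Real.pi_pos
  have h0 : ∀ u, HasDerivAt Real.tanh (1 - Real.tanh u ^ 2) u := by
    intro u
    have hc := (Real.cosh_pos u).ne'
    have h1 := (Real.hasDerivAt_sinh u).div (Real.hasDerivAt_cosh u) hc
    have h2 : Real.tanh = Real.sinh / Real.cosh := funext Real.tanh_eq_sinh_div_cosh
    rw [h2]
    refine h1.congr_deriv ?_
    simp only [Pi.div_apply]
    field_simp
  have h1 : HasDerivAt (tanhStrip d)
      ((1 - Real.tanh (Real.pi / (4 * d) * t) ^ 2) * (Real.pi / (4 * d) * 1)) t :=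
    (h0 (Real.pi / (4 * d) * t)).comp t ((hasDerivAt_id t).const_mul (Real.pi / (4 * d)))
  rw [h1.deriv, tanhStrip]
  field_simp

theorem abs_tanhStrip_lt_one (d t : ℝ) : |tanhStrip d t| < 1 := Real.abs_tanh_lt_one _

/-- The conformal map of the unit disc onto the strip that sends the origin to the real point
`x`. -/
def discToStrip (d x : ℝ) (s : ℂ) : ℂ := x + 2 * d / Real.pi * Complex.log ((1 + s) / (1 - s))

theorem cayley_re_pos {s : ℂ} (hs : s ∈ Metric.ball (0 : ℂ) 1) : 0 < ((1 + s) / (1 - s)).re := by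
  have hn : Complex.normSq s < 1 := by
    rw [Complex.normSq_eq_norm_sq]
    have : ‖s‖ < 1 := by simpa using hs
    nlinarith [norm_nonneg s]
  have hne : 1 - s ≠ 0 := by
    intro h
    rw [sub_eq_zero] at h
    rw [← h] at hn
    simp at hn
  have hpos : 0 < Complex.normSq (1 - s) := Complex.normSq_pos.2 hne
  rw [Complex.div_re, ← add_div]
  refine div_pos ?_ hpos
  rw [Complex.normSq_apply] at hn
  simp
  nlinarith

theorem discToStrip_mem {d : ℝ} (hd : 0 < d) (x : ℝ) {s : ℂ} (hs : s ∈ Metric.ball (0 : ℂ) 1) :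
    discToStrip d x s ∈ strip d := by
  have hpi := Real.pi_pos
  have h := Complex.abs_arg_lt_pi_div_two_iff.2 (Or.inl (cayley_re_pos hs))
  have he : (discToStrip d x s).im = 2 * d / Real.pi * ((1 + s) / (1 - s)).arg := by
    rw [discToStrip, show (2 * (d : ℂ) / Real.pi) = ((2 * d / Real.pi : ℝ) : ℂ) by push_cast; rfl,
      Complex.add_im, Complex.ofReal_im, Complex.im_ofReal_mul, Complex.log_im, zero_add]
  have hk : 0 < 2 * d / Real.pi := by positivity
  rw [strip, Set.mem_ofPred_eq, he, abs_mul, abs_of_pos hk]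
  calc 2 * d / Real.pi * |((1 + s) / (1 - s)).arg| < 2 * d / Real.pi * (Real.pi / 2) :=
        mul_lt_mul_of_pos_left h hk
    _ = d := by field_simp

theorem differentiableOn_discToStrip (d x : ℝ) :
    DifferentiableOn ℂ (discToStrip d x) (Metric.ball 0 1) := by
  intro s hs
  have hne : 1 - s ≠ 0 := by
    intro h
    have := cayley_re_pos hs
    simp [h] at this
  have h1 : DifferentiableAt ℂ (fun s : ℂ => (1 + s) / (1 - s)) s :=
    DifferentiableAt.div (by fun_prop) (by fun_prop) hne
  have h2 := h1.clog (Or.inl (cayley_re_pos hs))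
  exact ((h2.const_mul _).const_add _).differentiableWithinAt

theorem discToStrip_tanhStrip {d : ℝ} (hd : 0 < d) (x y : ℝ) :
    discToStrip d x (tanhStrip d (y - x)) = y := by
  have hpi := Real.pi_pos
  rw [discToStrip, tanhStrip]
  set u := Real.pi / (4 * d) * (y - x) with hu
  have h1 : (1 + Real.tanh u) / (1 - Real.tanh u) = Real.exp (2 * u) := by
    rw [Real.tanh_eq_sinh_div_cosh, Real.sinh_eq, Real.cosh_eq,
      show 2 * u = u - -u by ring, Real.exp_sub]
    have hp := Real.exp_pos u
    have hm := Real.exp_pos (-u)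
    field_simp
    ring
  have h2 : ((1 + (Real.tanh u : ℂ)) / (1 - (Real.tanh u : ℂ))) = ((Real.exp (2 * u) : ℝ) : ℂ) := by
    rw [← h1]; push_cast; rfl
  rw [h2, ← Complex.ofReal_log (Real.exp_pos _).le, Real.log_exp]
  have h3 : (x : ℂ) + 2 * d / Real.pi * ((2 * u : ℝ) : ℂ) =
      ((x + 2 * d / Real.pi * (2 * u) : ℝ) : ℂ) := by push_cast; ring
  rw [h3]
  congr 1
  rw [hu]
  field_simp
  ring

/-- The disc estimate transported to the strip: interpolation of a bounded analytic function at
real points, evaluated at another real point. -/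
theorem strip_interpolation_error {d : ℝ} (hd : 0 < d) {ι : Type*} [DecidableEq ι] (S : Finset ι)
    (a : ι → ℝ) (hinj : Set.InjOn a S) {x : ℝ} (hx : ∀ m ∈ S, x ≠ a m) {h : ℂ → ℂ} {M : ℝ}
    (hh : DifferentiableOn ℂ h (strip d)) (hM : ∀ z ∈ strip d, ‖h z‖ ≤ M) :
    ‖h x - ∑ j ∈ S, h (a j) * (((∏ m ∈ S.erase j, tanhStrip d (x - a m)) *
        (1 - tanhStrip d (a j - x) ^ 2) / ∏ m ∈ S.erase j, tanhStrip d (a j - a m) : ℝ) : ℂ)‖ ≤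
      M * ∏ m ∈ S, |tanhStrip d (x - a m)| := by
  have hTinj := (tanhStrip_strictMono hd).injective
  have key := disc_interpolation_error S (fun m => tanhStrip d (a m - x))
    (fun i hi j hj hij => hinj hi hj (by
      have := hTinj hij
      linarith))
    (fun m hm h0 => hx m hm (by
      rw [← tanhStrip_zero d] at h0
      have := hTinj h0
      linarith))
    (fun m _ => abs_tanhStrip_lt_one _ _)
    (g := h ∘ discToStrip d x) (M := M)
    (hh.comp (differentiableOn_discToStrip d x) fun s hs => discToStrip_mem hd x hs)
    (fun s hs => hM _ (discToStrip_mem hd x hs))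
  have h0 : discToStrip d x 0 = x := by simp [discToStrip]
  have hswap : ∀ m, tanhStrip d (a m - x) = -tanhStrip d (x - a m) := fun m => by
    rw [← tanhStrip_neg, neg_sub]
  simp only [Function.comp, h0, discToStrip_tanhStrip hd] at key
  have hprod : ∏ m ∈ S, |tanhStrip d (a m - x)| = ∏ m ∈ S, |tanhStrip d (x - a m)| :=
    Finset.prod_congr rfl fun m _ => by rw [hswap, abs_neg]
  rw [hprod] at key
  refine le_of_eq_of_le ?_ key
  congr 2
  refine Finset.sum_congr rfl fun j _ => ?_
  congr 2
  rw [div_eq_mul_inv, ← Finset.prod_inv_distrib]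
  congr 1
  · congr 1
    exact Finset.prod_congr rfl fun m _ => by rw [hswap, neg_neg]
  · refine Finset.prod_congr rfl fun m _ => ?_
    rw [show a j - a m = (a j - x) - (a m - x) by ring, tanhStrip_sub, inv_div]

theorem norm_div_le_hardyNorm {d : ℝ} {w f : ℂ → ℂ} (hf : MemHardy d w f) {z : ℂ}
    (hz : z ∈ strip d) : ‖f z / w z‖ ≤ hardyNorm d w f :=
  le_ciSup hf.2 ⟨z, hz⟩

theorem norm_ofReal_weight {d : ℝ} {w : ℂ → ℂ} (hw : IsWeight d w) (x : ℝ) :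
    ‖w x‖ = realPart w x := by
  obtain ⟨h1, h2⟩ := hw.real_pos x
  have h3 : w x = ((realPart w x : ℝ) : ℂ) := Complex.ext (by simp [realPart]) (by simp [h1])
  rw [h3, Complex.norm_real, Real.norm_of_nonneg]
  exact h2.le

/-- Pointwise error of the approximation formula away from the sampling points. -/
theorem norm_sub_approx_le {d : ℝ} (hd : 0 < d) {w f : ℂ → ℂ} (hw : IsWeight d w)
    (hf : MemHardy d w f) {N : ℕ} {a : ℤ → ℝ} (hinj : Set.InjOn a (Finset.Icc (-(N : ℤ)) N))
    {x : ℝ} (hx : ∀ m ∈ Finset.Icc (-(N : ℤ)) N, x ≠ a m) :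
    ‖f x - approx d w f N a x‖ ≤ hardyNorm d w f *
      (realPart w x * ∏ m ∈ Finset.Icc (-(N : ℤ)) N, |tanhStrip d (x - a m)|) := by
  have key := strip_interpolation_error hd (Finset.Icc (-(N : ℤ)) N) a hinj hx
    (hf.1.div hw.memB.analytic hw.ne_zero) (fun z hz => norm_div_le_hardyNorm hf hz)
  have hwx : w x ≠ 0 := hw.ne_zero x (ofReal_mem_strip hd x)
  have he : f x - approx d w f N a x = w x * ((f / w) x - ∑ j ∈ Finset.Icc (-(N : ℤ)) N,
      (f / w) (a j) * (((∏ m ∈ (Finset.Icc (-(N : ℤ)) N).erase j, tanhStrip d (x - a m)) *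
        (1 - tanhStrip d (a j - x) ^ 2) /
          ∏ m ∈ (Finset.Icc (-(N : ℤ)) N).erase j, tanhStrip d (a j - a m) : ℝ) : ℂ)) := by
    rw [mul_sub, Finset.mul_sum, approx]
    congr 1
    · simp only [Pi.div_apply]
      field_simp
    · refine Finset.sum_congr rfl fun j _ => ?_
      rw [deriv_tanhStrip hd, blaschkeOmit, blaschkeOmit]
      push_cast
      simp only [Pi.div_apply]
      ring
  rw [he, norm_mul, norm_ofReal_weight hw, mul_left_comm]
  exact mul_le_mul_of_nonneg_left key (hw.real_pos x).2.le

/-- The formula reproduces the function at the sampling points. -/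
theorem approx_sampling_point {d : ℝ} (hd : 0 < d) {w f : ℂ → ℂ} (hw : IsWeight d w) {N : ℕ}
    {a : ℤ → ℝ} (hinj : Set.InjOn a (Finset.Icc (-(N : ℤ)) N)) {m : ℤ}
    (hm : m ∈ Finset.Icc (-(N : ℤ)) N) : approx d w f N a (a m) = f (a m) := by
  rw [approx, Finset.sum_eq_single m]
  · rw [deriv_tanhStrip hd, sub_self, tanhStrip_zero]
    have hw0 : w (a m) ≠ 0 := hw.ne_zero _ (ofReal_mem_strip hd _)
    have hB : blaschkeOmit d N a m (a m) ≠ 0 := by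
      rw [blaschkeOmit]
      refine Finset.prod_ne_zero_iff.2 fun k hk h0 => ?_
      rw [← tanhStrip_zero d] at h0
      have h1 := sub_eq_zero.1 ((tanhStrip_strictMono hd).injective h0)
      exact (Finset.mem_erase.1 hk).1 (hinj (Finset.mem_of_mem_erase hk) hm h1.symm)
    have hB' : ((blaschkeOmit d N a m (a m) : ℝ) : ℂ) ≠ 0 := by exact_mod_cast hB
    rw [div_self (mul_ne_zero hB' hw0)]
    simp
  · intro j _ hjm
    have : blaschkeOmit d N a j (a m) = 0 := by
      rw [blaschkeOmit]
      refine Finset.prod_eq_zero (Finset.mem_erase.2 ⟨hjm.symm, hm⟩) ?_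
      rw [sub_self, tanhStrip_zero]
    rw [this]
    simp
  · exact fun h => absurd hm h

/-- The existence of sampling points forces the Fourier transform of the density to be integrable:
otherwise the integral defining the density has the value `0` everywhere. -/
theorem integrable_densityFourier_of_isSampling {d : ℝ} {w : ℂ → ℂ} {N : ℕ} {α : ℝ} {a : ℤ → ℝ}
    (hN : 1 ≤ N) (ha : IsSampling d w N α a) : Integrable (densityFourier d w α) := by
  by_contra hF
  have h0 : ∀ x, density d w α x = 0 := by
    intro x
    have hni : ¬Integrable fun ω : ℝ =>
        densityFourier d w α ω * Complex.exp (Complex.I * ω * x) := by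
      intro hi
      refine hF ((integrable_ft_mul_cexp hi (-x)).congr (Eventually.of_forall fun ω => ?_))
      simp only
      rw [mul_assoc, ← Complex.exp_add]
      push_cast
      ring_nf
      simp
    rw [density_eq, integral_undef hni]
    simp
  have h1 := ha 1 (by rw [Finset.mem_Icc]; omega)
  rw [densityIntegral] at h1
  simp [h0] at h1

end StripApprox

end

theorem mainTheorem1 (d : ℝ) (hd : 0 < d) (w : ℂ → ℂ) (hw : StripApprox.IsWeight d w)
    (α : ℕ → ℝ) (a : ℕ → ℤ → ℝ)
    (hα : ∀ N : ℕ, 1 ≤ N → StripApprox.IsEndpoint d w N (α N))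
    (ha : ∀ N : ℕ, 1 ≤ N → StripApprox.IsSampling d w N (α N) (a N))
    (c l : ℝ) (hc : 0 < c) (hl : 0 < l)
    (hν : ∀ N : ℕ, 1 ≤ N → ∀ x ∈ Set.Icc (-(α N)) (α N),
      |StripApprox.density d w (α N) x| ≤ c * (N : ℝ) ^ l) :
    ∃ (C c' : ℝ) (N₀ : ℕ), ∀ N : ℕ, N₀ ≤ N → ∀ f : ℂ → ℂ, StripApprox.MemHardy d w f →
      BddAbove (Set.range fun x : ℝ => ‖f x - StripApprox.approx d w f N (a N) x‖) ∧
      (⨆ x : ℝ, ‖f x - StripApprox.approx d w f N (a N) x‖) ≤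
        C * StripApprox.hardyNorm d w f * (N : ℝ) ^ c' *
          Real.exp (-(StripApprox.rateK d w (α N))) := by
  have hpi := Real.pi_pos
  refine ⟨Real.exp (1 + 16 * d / Real.pi) * (c + 1) ^ (1 + 8 * d / Real.pi),
    l * (1 + 8 * d / Real.pi), 1, fun N hN f hf => ?_⟩
  have hF := StripApprox.integrable_densityFourier_of_isSampling hN (ha N hN)
  have hq := StripApprox.quantileData_density hd hw (hα N hN) hF (ha N hN)
  have hinj : Set.InjOn (a N) (Finset.Icc (-(N : ℤ)) N) := by
    intro i hi j hj hij
    rcases lt_trichotomy i j with h | h | h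
    · exact absurd hij (hq.lt hi hj h).ne
    · exact h
    · exact absurd hij.symm (hq.lt hj hi h).ne
  have hN1 : (1 : ℝ) ≤ N := by exact_mod_cast hN
  have hNl : 1 ≤ (N : ℝ) ^ l := Real.one_le_rpow hN1 hl.le
  have hS : 1 ≤ (c + 1) * (N : ℝ) ^ l := by nlinarith
  have hM0 : 0 ≤ StripApprox.hardyNorm d w f :=
    (norm_nonneg _).trans (StripApprox.norm_div_le_hardyNorm hf (StripApprox.ofReal_mem_strip hd 0))
  have hbound : ∀ x : ℝ, ‖f x - StripApprox.approx d w f N (a N) x‖ ≤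
      Real.exp (1 + 16 * d / Real.pi) * (c + 1) ^ (1 + 8 * d / Real.pi) *
        StripApprox.hardyNorm d w f * (N : ℝ) ^ (l * (1 + 8 * d / Real.pi)) *
          Real.exp (-(StripApprox.rateK d w (α N))) := by
    intro x
    by_cases hx : ∀ m ∈ Finset.Icc (-(N : ℤ)) N, x ≠ a N m
    · have h1 := StripApprox.norm_sub_approx_le hd hw hf hinj hx
      have h2 := StripApprox.weight_mul_prod_tanh_le hd hw (hα N hN) hF (ha N hN) hS
        (fun y hy => (hν N hN y hy).trans (by nlinarith)) hx
      refine (h1.trans (mul_le_mul_of_nonneg_left h2 hM0)).trans_eq ?_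
      rw [Real.mul_rpow (by linarith) (by linarith), ← Real.rpow_mul (by linarith)]
      ring
    · push Not at hx
      obtain ⟨m, hm, rfl⟩ := hx
      rw [StripApprox.approx_sampling_point hd hw hinj hm, sub_self, norm_zero]
      positivity
  exact ⟨⟨_, Set.forall_mem_range.2 hbound⟩, ciSup_le hbound⟩
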